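/- Let $T>0$ and $p\in(1,\infty)$. Let $\phi\in L^1([0,T]^2;\mathbb R)$ be symmetric and positive definite (i.e. $\int_0^T\!\int_0^T f(u)f(v)\phi(u,v)\,du\,dv\ge 0$ for all $f\in L^p([0,T];\mathbb R)$), and suppose that there is $C\in(0,\infty)$ with $$\int_0^T\!\!\int_0^T |f(u)f(v)\phi(u,v)|\,du\,dv\le C\|f\|_{L^p([0,T];\mathbb R)}^2\quad\text{for all } f\in L^p([0,T];\mathbb R).$$ Let $g_n=(g_n(t))_{t\in[0,T]}$, $n\in\mathbb N$, be independent centred real Gaussian processes on a probability space $(\Omega,\mathcal F,P)$, each with covariance function $R(t,s)=\int_0^s\int_0^t\phi(u,v)\,du\,dv$. Let $\mathcal H$ and $U$ be separable real Hilbert spaces, $(e_n)_{n\in\mathbb N}$ an orthonormal basis of $U$, and $\lambda_n>0$ with $\sum_n\sqrt{\lambda_n}<\infty$; put $Qz:=\sum_n\lambda_n\langle z,e_n\rangle_U e_n$ for $z\in U$. Let $L(U,\mathcal H)$ be the space of bounded linear operators with the operator norm. For each $n$ there is exactly one continuous linear map $f\mapsto\int_0^T f\,dg_n$ from $L^p([0,T];\mathcal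 H)$ to $L^2(\Omega;\mathcal H)$ that sends $1_{(s,t]}x$ to $(g_n(t)-g_n(s))x$ for all $0\le s\le t\le T$ and $x\in\mathcal H$. Put $\int_0^t f\,dg_n:=\int_0^T 1_{(0,t]}f\,dg_n$. For $h\in L^p([0,T];L(U,\mathcal H))$ and $t\in[0,T]$ the series $$\int_0^t h(s)\,dG(s):=\sum_{n}\sqrt{\lambda_n}\int_0^t h(s)e_n\,dg_n(s)$$ converges in $L^2(\Omega;\mathcal H)$. Moreover: (i) For every $h\in L^p([0,T];L(U,\mathcal H))$, $\big(\int_0^t h\,dG\big)_{t\in[0,T]}$ is an $\mathcal H$-valued Gaussian process. (ii) If $h\in L^{p+\varepsilon}([0,T];L(U,\mathcal H))$ for some $\varepsilon>0$, then this process has a modification with continuous sample paths in $\mathcal H$. (iii) For all $h_1,h_2\in L^p([0,T];L(U,\mathcal H))$ and $x,y\in\mathcal H$, $$E\Big(\Big\langle\int_0^T h_1\,dG,x\Big\rangle_{\mathcal H}\Big\langle\int_0^T h_2\,dG,y\Big\rangle_{\mathcal H}\Big)=\int_0^T\!\!\int_0^T\langle h_2(s')Qh_1(s)^*x,y\rangle_{\mathcal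 H}\,\phi(s,s')\,ds\,ds'.$$ (iv) For all $h_1,h_2\in L^p([0,T];L(U,\mathcal H))$, the operators $h_2(s')Qh_1(s)^*$ are of trace class and $$E\Big\langle\int_0^T h_1\,dG,\int_0^T h_2\,dG\Big\rangle_{\mathcal H}=\int_0^T\!\!\int_0^T\mathrm{Tr}\big(h_2(s')Qh_1(s)^*\big)\,\phi(s,s')\,ds\,ds'.$$ The integrands on the right-hand sides of (iii) and (iv) are integrable on $[0,T]^2$. -/

import Mathlib

open MeasureTheory ProbabilityTheory Set
open scoped ENNReal NNReal RealInnerProductSpace InnerProduct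

noncomputable section

namespace GaussianIntegral

/-- Lebesgue measure `ds` on the time interval `[0, T]`. -/
abbrev timeMeasure (T : ℝ) : Measure ℝ := volume.restrict (Icc 0 T)

/-- The condition on the kernel `φ` (for the exponent `p`): it is integrable on `[0,T]²`, symmetric,
positive definite (as an integral kernel, hence tested against functions in `L^p`), and there is
`C ∈ (0, ∞)` with `∫∫ |f(u) f(v) φ(u,v)| du dv ≤ C ‖f‖²_{L^p}` for all real `f ∈ L^p([0,T])`. -/
structure KernelCondition (T : ℝ) (φ : ℝ → ℝ → ℝ) (p : ℝ≥0∞) : Prop where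
  integrable : Integrable (fun z : ℝ × ℝ => φ z.1 z.2) ((timeMeasure T).prod (timeMeasure T))
  symm : ∀ᵐ z : ℝ × ℝ ∂((timeMeasure T).prod (timeMeasure T)), φ z.1 z.2 = φ z.2 z.1
  posDef : ∀ f : ℝ → ℝ, MemLp f p (timeMeasure T) →
    0 ≤ ∫ v in (0 : ℝ)..T, ∫ u in (0 : ℝ)..T, f u * f v * φ u v
  bound : ∃ C : ℝ≥0, 0 < C ∧ ∀ f : ℝ → ℝ, MemLp f p (timeMeasure T) →
    ∫⁻ v in Icc 0 T, ∫⁻ u in Icc 0 T, ‖f u * f v * φ u v‖ₑ ≤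
      C * eLpNorm f p (timeMeasure T) ^ 2

/-- The covariance function `R(t,s) = ∫_0^s ∫_0^t φ(u,v) du dv`. -/
def kernelCov (φ : ℝ → ℝ → ℝ) (t s : ℝ) : ℝ :=
  ∫ v in (0 : ℝ)..s, ∫ u in (0 : ℝ)..t, φ u v

section Wiener

variable {Ω : Type*} [MeasurableSpace Ω] (P : Measure Ω)
  {H : Type*} [NormedAddCommGroup H] [InnerProductSpace ℝ H]
  {T : ℝ} (p : ℝ≥0∞) [Fact (1 ≤ p)] (g : Icc (0 : ℝ) T → Ω → ℝ)

/-- `I : L^p([0,T]; H) → L²(Ω; H)` is the integral operator `f ↦ ∫_0^T f dg`: it is linear and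
continuous, and sends the step function `1_{(s,t]} x` to `(g(t) - g(s)) x`. As step functions are
dense in `L^p([0,T]; H)` for `p < ∞`, there is at most one such operator. -/
def IsWienerIntegral (I : Lp H p (timeMeasure T) →L[ℝ] Lp H 2 P) : Prop :=
  ∀ s t : Icc (0 : ℝ) T, s ≤ t → ∀ x : H,
    I (indicatorConstLp p (measurableSet_Ioc : MeasurableSet (Ioc (s : ℝ) t))
      (measure_ne_top (timeMeasure T) _) x) =ᵐ[P] fun ω => (g t ω - g s ω) • x

open Classical in
/-- The integral operator `f ↦ ∫_0^T f dg` from `L^p([0,T]; H)` to `L²(Ω; H)`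
(zero if there is none). -/
def wienerIntegralL : Lp H p (timeMeasure T) →L[ℝ] Lp H 2 P :=
  if h : ∃ I : Lp H p (timeMeasure T) →L[ℝ] Lp H 2 P, IsWienerIntegral P p g I
  then h.choose else 0

open Classical in
/-- `∫_0^t f dg := ∫_0^T 1_{(0,t]} f dg ∈ L²(Ω; H)` for `f ∈ L^p([0,T]; H)`
(zero for other `f`). -/
def wienerIntegral (f : ℝ → H) (t : ℝ) : Lp H 2 P :=
  if h : MemLp ((Ioc 0 t).indicator f) p (timeMeasure T)
  then wienerIntegralL P p g h.toLp else 0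

end Wiener

section Series

variable {Ω : Type*} [MeasurableSpace Ω] (P : Measure Ω)
  {U : Type*} [NormedAddCommGroup U] [InnerProductSpace ℝ U]
  {H : Type*} [NormedAddCommGroup H] [InnerProductSpace ℝ H]
  {T : ℝ} (p : ℝ≥0∞) [Fact (1 ≤ p)] (g : ℕ → Icc (0 : ℝ) T → Ω → ℝ)
  (e : HilbertBasis ℕ ℝ U) (lam : ℕ → ℝ)

/-- The `n`-th term `√λ_n ∫_0^t h(s) e_n dg_n(s)`. -/
def gaussianTerm (h : ℝ → U →L[ℝ] H) (t : ℝ) (n : ℕ) : Lp H 2 P :=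
  √(lam n) • wienerIntegral P p (g n) (fun s => h s (e n)) t

/-- `∫_0^t h dG = ∑_n √λ_n ∫_0^t h(s) e_n dg_n(s)`, a series in `L²(Ω; H)`. -/
def gaussianIntegral (h : ℝ → U →L[ℝ] H) (t : ℝ) : Lp H 2 P :=
  ∑' n, gaussianTerm P p g e lam h t n

/-- The operator `Q = ∑_n λ_n ⟨·, e_n⟩ e_n` on `U`. -/
def covOp : U →L[ℝ] U := ∑' n, lam n • InnerProductSpace.rankOne ℝ (e n) (e n)

end Series

/-- The series that defines `Q` converges when `∑ |λ_n| < ∞`, and so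
`Q z = ∑_n λ_n ⟨z, e_n⟩ e_n`. -/
theorem hasSum_covOp {U : Type*} [NormedAddCommGroup U] [InnerProductSpace ℝ U] [CompleteSpace U]
    (e : HilbertBasis ℕ ℝ U) (lam : ℕ → ℝ) (hlam : Summable fun n => |lam n|) (z : U) :
    HasSum (fun n => (lam n * ⟪z, e n⟫) • e n) (covOp e lam z) := by
  have hs : Summable fun n => lam n • InnerProductSpace.rankOne ℝ (e n) (e n) := by
    refine Summable.of_norm (hlam.congr fun n => ?_)
    rw [norm_smul, InnerProductSpace.norm_rankOne, e.orthonormal.1 n]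
    simp
  have h : HasSum _ (covOp e lam z) := hs.hasSum.mapL (ContinuousLinearMap.apply ℝ U z)
  convert h using 2 with n
  simp [InnerProductSpace.rankOne_apply, real_inner_comm, mul_smul]

section Trace

variable {H : Type*} [NormedAddCommGroup H] [InnerProductSpace ℝ H]

/-- Trace-class (nuclear) operators on a Hilbert space: `A z = ∑_n ⟨a_n, z⟩ b_n` with
`∑_n ‖a_n‖ ‖b_n‖ < ∞`. -/
def IsTraceClass (A : H →L[ℝ] H) : Prop :=
  ∃ a b : ℕ → H, (Summable fun n => ‖a n‖ * ‖b n‖) ∧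
    ∀ z, HasSum (fun n => ⟪a n, z⟫ • b n) (A z)

/-- The trace `Tr A = ∑_i ⟨A b_i, b_i⟩` computed in the orthonormal basis `b`. For trace-class
`A` it does not depend on `b`. -/
def trace {ι : Type*} (b : HilbertBasis ι ℝ H) (A : H →L[ℝ] H) : ℝ :=
  ∑' i, ⟪A (b i), b i⟫

end Trace

end GaussianIntegral

end

/-! The bound on `φ`, polarised, makes B(f,k) = ∫∫⟨f(u),k(v)⟩φ(u,v) du dv a bounded bilinear form on
L^p([0,T];H) (`exists_kernelForm_clm`). For step functions the covariance R gives E⟨∫f dg, ∫k dg⟩ =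
B(f,k). Hence the elementary integral is bounded from the L^p norm to the L² norm; as steps are
dense (`eq_top_of_stepLp_mem`), it extends uniquely, and the identity persists
(`IsWienerIntegral.inner_eq`). The operator bound depends only on `φ`, so the series for ∫h dG
converges absolutely as soon as ∑√λ_n < ∞.

Gaussianity: the closed linear span in L²(Ω) of all g_n(t) consists of centred Gaussian variables
(`exists_gaussianSpace`), and L(∫_0^t h dG) lies in it for every continuous functional L on H.

Continuity: by Hölder, the L^p norm of 1_{(s,t]}h is at most ‖h‖_q |t-s|^δ with q = p+ε and δ = 1/p
- 1/q > 0. Moments of every order of a centred Gaussian vector are controlled by its second moment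
(`exists_lintegral_enorm_pow_le`), so a high enough moment brings the increments under a Kolmogorov
criterion (`exists_continuous_modification`).

Covariances: independence kills the terms with n ≠ m, leaving ∑λ_n B(h₁e_n, h₂e_n), or its analogue
with the functions paired with x and y. Domination moves the sum inside the integral
(`hasSum_kernelForm`), where it is the expansion of the trace, or of the matrix element, of h₂Qh₁*.
-/

noncomputable section

namespace GaussianIntegral

/-! ### Polarising the kernel bound -/

section KernelForm

variable {T : ℝ} {φ : ℝ → ℝ → ℝ} {p : ℝ≥0∞}

/-- The hypothesis only controls the diagonal, but it does so with absolute values. Testing it on a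
weighted sum of |f| and |k| therefore dominates the mixed term, with no cancellation to undo. -/
theorem KernelCondition.exists_lintegral_le (hφ : KernelCondition T φ p) (hp : 1 ≤ p) :
    ∃ K : ℝ≥0, ∀ f k : ℝ → ℝ, MemLp f p (timeMeasure T) → MemLp k p (timeMeasure T) →
      ∫⁻ z : ℝ × ℝ, ‖f z.1‖ₑ * ‖k z.2‖ₑ * ‖φ z.1 z.2‖ₑ ∂((timeMeasure T).prod (timeMeasure T)) ≤
        K * eLpNorm f p (timeMeasure T) * eLpNorm k p (timeMeasure T) := by
  obtain ⟨C, -, hC⟩ := hφ.bound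
  refine ⟨4 * C, fun f k hf hk => ?_⟩
  set ν := timeMeasure T
  have hp0 : p ≠ 0 := (zero_lt_one.trans_le hp).ne'
  set a := eLpNorm f p ν with ha
  set b := eLpNorm k p ν with hb
  have ha_top : a ≠ ∞ := hf.2.ne
  have hb_top : b ≠ ∞ := hk.2.ne
  rcases eq_or_ne a 0 with ha0 | ha0
  · have hf0 : ∀ᵐ u ∂ν, f u = 0 := (eLpNorm_eq_zero_iff hf.1 hp0).1 ha0
    refine le_of_eq_of_le ((lintegral_eq_zero_iff' ?_).2 ?_) zero_le
    · have := hφ.integrable.1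
      exact (hf.1.comp_fst.enorm.mul hk.1.comp_snd.enorm).mul this.enorm
    · filter_upwards [Measure.quasiMeasurePreserving_fst.ae hf0] with z hz
      simp [hz]
  rcases eq_or_ne b 0 with hb0 | hb0
  · have hk0 : ∀ᵐ u ∂ν, k u = 0 := (eLpNorm_eq_zero_iff hk.1 hp0).1 hb0
    refine le_of_eq_of_le ((lintegral_eq_zero_iff' ?_).2 ?_) zero_le
    · have := hφ.integrable.1
      exact (hf.1.comp_fst.enorm.mul hk.1.comp_snd.enorm).mul this.enorm
    · filter_upwards [Measure.quasiMeasurePreserving_snd.ae hk0] with z hz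
      simp [hz]
  -- The crossed weights give both summands the norm ab. Then w(u)w(v) ≥ ab|f(u)||k(v)| while ‖w‖² ≤
  -- 4(ab)², and dividing by ab yields 4C; the cases ab = 0 are settled above.
  set w : ℝ → ℝ := b.toReal • (fun u => ‖f u‖) + a.toReal • (fun u => ‖k u‖) with hw
  have hwm : MemLp w p ν := (hf.norm.const_smul _).add (hk.norm.const_smul _)
  have hnorm : eLpNorm w p ν ≤ 2 * (a * b) := by
    refine (eLpNorm_add_le (hf.norm.const_smul _).1 (hk.norm.const_smul _).1 hp).trans ?_
    rw [eLpNorm_const_smul, eLpNorm_const_smul, eLpNorm_norm, eLpNorm_norm,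
      Real.enorm_of_nonneg ENNReal.toReal_nonneg, Real.enorm_of_nonneg ENNReal.toReal_nonneg,
      ENNReal.ofReal_toReal ha_top, ENNReal.ofReal_toReal hb_top, ← ha, ← hb, mul_comm b a, two_mul]
  have h1 := hC w hwm
  have hmeas : AEMeasurable (fun z : ℝ × ℝ => ‖w z.1 * w z.2 * φ z.1 z.2‖ₑ) (ν.prod ν) :=
    ((hwm.1.comp_fst.mul hwm.1.comp_snd).mul hφ.integrable.1).enorm
  rw [← lintegral_prod_symm (fun z : ℝ × ℝ => ‖w z.1 * w z.2 * φ z.1 z.2‖ₑ) hmeas] at h1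
  have h2 : a * b * ∫⁻ z : ℝ × ℝ, ‖f z.1‖ₑ * ‖k z.2‖ₑ * ‖φ z.1 z.2‖ₑ ∂(ν.prod ν) ≤
      ∫⁻ z : ℝ × ℝ, ‖w z.1 * w z.2 * φ z.1 z.2‖ₑ ∂(ν.prod ν) := by
    rw [← lintegral_const_mul' _ _ (ENNReal.mul_ne_top ha_top hb_top)]
    refine lintegral_mono fun z => ?_
    have hw1 : b * ‖f z.1‖ₑ ≤ ‖w z.1‖ₑ := by
      rw [← ENNReal.ofReal_toReal hb_top, ← ofReal_norm, ← ofReal_norm,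
        ← ENNReal.ofReal_mul ENNReal.toReal_nonneg]
      refine ENNReal.ofReal_le_ofReal (le_trans ?_ (le_abs_self _))
      simp only [hw, Pi.add_apply, Pi.smul_apply, smul_eq_mul]
      exact le_add_of_nonneg_right (by positivity)
    have hw2 : a * ‖k z.2‖ₑ ≤ ‖w z.2‖ₑ := by
      rw [← ENNReal.ofReal_toReal ha_top, ← ofReal_norm, ← ofReal_norm,
        ← ENNReal.ofReal_mul ENNReal.toReal_nonneg]
      refine ENNReal.ofReal_le_ofReal (le_trans ?_ (le_abs_self _))
      simp only [hw, Pi.add_apply, Pi.smul_apply, smul_eq_mul]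
      exact le_add_of_nonneg_left (by positivity)
    calc a * b * (‖f z.1‖ₑ * ‖k z.2‖ₑ * ‖φ z.1 z.2‖ₑ)
        = (b * ‖f z.1‖ₑ) * (a * ‖k z.2‖ₑ) * ‖φ z.1 z.2‖ₑ := by ring
      _ ≤ ‖w z.1‖ₑ * ‖w z.2‖ₑ * ‖φ z.1 z.2‖ₑ := by gcongr
      _ = ‖w z.1 * w z.2 * φ z.1 z.2‖ₑ := by rw [enorm_mul, enorm_mul]
  have hab0 : a * b ≠ 0 := mul_ne_zero ha0 hb0
  have hab_top : a * b ≠ ∞ := ENNReal.mul_ne_top ha_top hb_top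
  rw [← ENNReal.mul_le_mul_iff_right hab0 hab_top]
  calc _ ≤ _ := h2
    _ ≤ C * eLpNorm w p ν ^ 2 := h1
    _ ≤ C * (2 * (a * b)) ^ 2 := by gcongr
    _ = a * b * ((4 * C : ℝ≥0) * a * b) := by push_cast; ring

variable {E F : Type*} [NormedAddCommGroup E] [NormedAddCommGroup F]

theorem KernelCondition.integrable_norm_mul_norm (hφ : KernelCondition T φ p) (hp : 1 ≤ p)
    {f : ℝ → E} {k : ℝ → F} (hf : MemLp f p (timeMeasure T)) (hk : MemLp k p (timeMeasure T)) :
    Integrable (fun z : ℝ × ℝ => ‖f z.1‖ * ‖k z.2‖ * |φ z.1 z.2|)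
      ((timeMeasure T).prod (timeMeasure T)) := by
  obtain ⟨K, hK⟩ := hφ.exists_lintegral_le hp
  refine ⟨(hf.norm.1.comp_fst.mul hk.norm.1.comp_snd).mul hφ.integrable.abs.1, ?_⟩
  have h := hK _ _ hf.norm hk.norm
  simp only [hasFiniteIntegral_iff_enorm, enorm_mul, enorm_norm, ← Real.norm_eq_abs] at h ⊢
  exact h.trans_lt (ENNReal.mul_lt_top (ENNReal.mul_lt_top ENNReal.coe_lt_top hf.norm.2) hk.norm.2)

theorem KernelCondition.exists_integral_le (hφ : KernelCondition T φ p) (hp : 1 ≤ p) :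
    ∃ K : ℝ≥0, ∀ f k : ℝ → ℝ, MemLp f p (timeMeasure T) → MemLp k p (timeMeasure T) →
      ∫ z : ℝ × ℝ, ‖f z.1‖ * ‖k z.2‖ * |φ z.1 z.2| ∂((timeMeasure T).prod (timeMeasure T)) ≤
        K * (eLpNorm f p (timeMeasure T)).toReal * (eLpNorm k p (timeMeasure T)).toReal := by
  obtain ⟨K, hK⟩ := hφ.exists_lintegral_le hp
  refine ⟨K, fun f k hf hk => ?_⟩
  have h := hK _ _ hf hk
  rw [integral_eq_lintegral_of_nonneg_ae (ae_of_all _ fun z => by positivity)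
    (hφ.integrable_norm_mul_norm hp hf hk).1]
  refine ENNReal.toReal_le_of_le_ofReal (by positivity) ?_
  rw [ENNReal.ofReal_mul (by positivity), ENNReal.ofReal_mul (by positivity),
    ENNReal.ofReal_toReal hf.2.ne, ENNReal.ofReal_toReal hk.2.ne, ENNReal.ofReal_coe_nnreal]
  refine le_of_eq_of_le ?_ h
  congr 1 with z
  rw [← Real.enorm_of_nonneg (by positivity)]
  simp only [enorm_mul, enorm_norm, ← Real.norm_eq_abs]

end KernelForm

/-! ### The kernel form on Hilbert-space valued functions -/

section InnerKernelForm

variable {T : ℝ} {φ : ℝ → ℝ → ℝ} {p : ℝ≥0∞}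
  {H : Type*} [NormedAddCommGroup H] [InnerProductSpace ℝ H]

/-- The form `∫∫ ⟪f u, k v⟫ φ(u, v) du dv` on `[0, T]²`. -/
def kernelForm (T : ℝ) (φ : ℝ → ℝ → ℝ) (f k : ℝ → H) : ℝ :=
  ∫ z : ℝ × ℝ, ⟪f z.1, k z.2⟫ * φ z.1 z.2 ∂((timeMeasure T).prod (timeMeasure T))

theorem KernelCondition.integrable_inner (hφ : KernelCondition T φ p) (hp : 1 ≤ p) {f k : ℝ → H}
    (hf : MemLp f p (timeMeasure T)) (hk : MemLp k p (timeMeasure T)) :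
    Integrable (fun z : ℝ × ℝ => ⟪f z.1, k z.2⟫ * φ z.1 z.2)
      ((timeMeasure T).prod (timeMeasure T)) := by
  refine (hφ.integrable_norm_mul_norm hp hf hk).mono
    ((hf.1.comp_fst.inner hk.1.comp_snd).mul hφ.integrable.1) (ae_of_all _ fun z => ?_)
  rw [norm_mul, Real.norm_of_nonneg (by positivity : 0 ≤ ‖f z.1‖ * ‖k z.2‖ * |φ z.1 z.2|),
    Real.norm_eq_abs (φ _ _)]
  gcongr
  exact norm_inner_le_norm _ _

theorem kernelForm_congr {f f' k k' : ℝ → H} (hf : f =ᵐ[timeMeasure T] f')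
    (hk : k =ᵐ[timeMeasure T] k') : kernelForm T φ f k = kernelForm T φ f' k' := by
  refine integral_congr_ae ?_
  filter_upwards [Measure.quasiMeasurePreserving_fst.ae hf,
    Measure.quasiMeasurePreserving_snd.ae hk] with z h1 h2
  rw [h1, h2]

theorem KernelCondition.abs_kernelForm_le (hφ : KernelCondition T φ p) (hp : 1 ≤ p) {f k : ℝ → H}
    (hf : MemLp f p (timeMeasure T)) (hk : MemLp k p (timeMeasure T)) :
    |kernelForm T φ f k| ≤
      ∫ z : ℝ × ℝ, ‖f z.1‖ * ‖k z.2‖ * |φ z.1 z.2| ∂((timeMeasure T).prod (timeMeasure T)) := by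
  refine (abs_integral_le_integral_abs).trans (integral_mono (hφ.integrable_inner hp hf hk).abs
    (hφ.integrable_norm_mul_norm hp hf hk) fun z => ?_)
  simp only [abs_mul]
  gcongr
  exact abs_real_inner_le_norm _ _

theorem KernelCondition.exists_abs_kernelForm_le [Fact (1 ≤ p)] (hφ : KernelCondition T φ p) :
    ∃ K : ℝ, 0 ≤ K ∧ ∀ f k : Lp H p (timeMeasure T), |kernelForm T φ f k| ≤ K * ‖f‖ * ‖k‖ := by
  have hp : 1 ≤ p := Fact.out
  obtain ⟨K, hK⟩ := hφ.exists_integral_le hp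
  refine ⟨K, K.2, fun f k => ?_⟩
  have h := hK _ _ (Lp.memLp f).norm (Lp.memLp k).norm
  simp only [norm_norm, eLpNorm_norm] at h
  exact (hφ.abs_kernelForm_le hp (Lp.memLp f) (Lp.memLp k)).trans h

theorem KernelCondition.exists_kernelForm_clm [Fact (1 ≤ p)] (hφ : KernelCondition T φ p) :
    ∃ B : Lp H p (timeMeasure T) →L[ℝ] Lp H p (timeMeasure T) →L[ℝ] ℝ,
      ∀ f k, B f k = kernelForm T φ f k := by
  have hp : 1 ≤ p := Fact.out
  obtain ⟨K, -, hK⟩ := hφ.exists_abs_kernelForm_le (H := H)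
  have hi : ∀ f k : Lp H p (timeMeasure T), _ := fun f k =>
    hφ.integrable_inner hp (Lp.memLp f) (Lp.memLp k)
  let B₀ : Lp H p (timeMeasure T) →ₗ[ℝ] Lp H p (timeMeasure T) →ₗ[ℝ] ℝ :=
    LinearMap.mk₂ ℝ (fun f k => kernelForm T φ f k)
      (fun f f' k => by
        rw [kernelForm_congr (Lp.coeFn_add f f') ae_eq_rfl, kernelForm, kernelForm, kernelForm,
          ← integral_add (hi f k) (hi f' k)]
        congr 1 with z
        rw [Pi.add_apply, inner_add_left, add_mul])
      (fun c f k => by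
        rw [kernelForm_congr (Lp.coeFn_smul c f) ae_eq_rfl, kernelForm, kernelForm,
          smul_eq_mul, ← integral_const_mul]
        congr 1 with z
        rw [Pi.smul_apply, real_inner_smul_left, mul_assoc])
      (fun f k k' => by
        rw [kernelForm_congr ae_eq_rfl (Lp.coeFn_add k k'), kernelForm, kernelForm, kernelForm,
          ← integral_add (hi f k) (hi f k')]
        congr 1 with z
        rw [Pi.add_apply, inner_add_right, add_mul])
      (fun c f k => by
        rw [kernelForm_congr ae_eq_rfl (Lp.coeFn_smul c k), kernelForm, kernelForm,
          smul_eq_mul, ← integral_const_mul]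
        congr 1 with z
        rw [Pi.smul_apply, real_inner_smul_right, mul_assoc])
  exact ⟨B₀.mkContinuous₂ K hK, fun f k => rfl⟩

theorem KernelCondition.kernelForm_indicator (hφ : KernelCondition T φ p)
    {s t : ℝ} (hs : s ∈ Icc 0 T) (ht : t ∈ Icc 0 T) (x y : H) :
    kernelForm T φ ((Ioc 0 t).indicator fun _ => x) ((Ioc 0 s).indicator fun _ => y) =
      ⟪x, y⟫ * kernelCov φ t s := by
  have h1 : ∀ z : ℝ × ℝ, ⟪(Ioc 0 t).indicator (fun _ => x) z.1,
      (Ioc 0 s).indicator (fun _ => y) z.2⟫ * φ z.1 z.2 =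
      ⟪x, y⟫ * (Ioc 0 t ×ˢ Ioc 0 s).indicator (fun z : ℝ × ℝ => φ z.1 z.2) z := by
    intro z
    by_cases h1 : z.1 ∈ Ioc 0 t <;> by_cases h2 : z.2 ∈ Ioc 0 s <;>
      simp [indicator, h1, h2, -mem_Ioc]
  have hm : MeasurableSet (Ioc 0 t ×ˢ Ioc 0 s) := measurableSet_Ioc.prod measurableSet_Ioc
  have hsub : ∀ r ∈ Icc 0 T, Ioc 0 r ⊆ Icc 0 T := fun r hr u hu => ⟨hu.1.le, hu.2.trans hr.2⟩
  have hint := hφ.integrable.integrableOn (s := Ioc 0 t ×ˢ Ioc 0 s)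
  simp_rw [kernelForm, h1, integral_const_mul]
  rw [integral_indicator hm]
  rw [IntegrableOn] at hint
  rw [← Measure.prod_restrict, Measure.restrict_restrict measurableSet_Ioc,
    Measure.restrict_restrict measurableSet_Ioc, inter_eq_self_of_subset_left (hsub t ht),
    inter_eq_self_of_subset_left (hsub s hs)] at hint ⊢
  rw [integral_prod_symm _ hint, kernelCov, intervalIntegral.integral_of_le hs.1]
  simp_rw [intervalIntegral.integral_of_le ht.1]

end InnerKernelForm

/-! ### Density of step functions -/

section StepFunctions

variable {T : ℝ} {p : ℝ≥0∞} {H : Type*} [NormedAddCommGroup H]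

/-- `1_{(0, t]} x` as an element of `L^p([0, T]; H)`. -/
def stepLp (T : ℝ) (p : ℝ≥0∞) (t : ℝ) (x : H) : Lp H p (timeMeasure T) :=
  indicatorConstLp p (measurableSet_Ioc : MeasurableSet (Ioc 0 t))
    (measure_ne_top (timeMeasure T) _) x

theorem coeFn_stepLp (t : ℝ) (x : H) :
    stepLp T p t x =ᵐ[timeMeasure T] (Ioc 0 t).indicator fun _ => x :=
  indicatorConstLp_coeFn

theorem indicatorConstLp_Ioc_eq_sub {s t : ℝ} (hs : 0 ≤ s) (hst : s ≤ t) (x : H) :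
    indicatorConstLp p (measurableSet_Ioc : MeasurableSet (Ioc s t))
      (measure_ne_top (timeMeasure T) _) x = stepLp T p t x - stepLp T p s x := by
  rw [eq_sub_iff_add_eq, add_comm, stepLp, stepLp, ← indicatorConstLp_disjoint_union]
  · congr 1
    exact Ioc_union_Ioc_eq_Ioc hs hst
  · exact disjoint_left.2 fun u hu hu' => absurd hu.2 (not_le.2 hu'.1)

variable [NormedSpace ℝ H] [Fact (1 ≤ p)]

/-- Step functions span a dense subspace of `L^p([0, T]; H)`. -/
theorem eq_top_of_stepLp_mem (hT : 0 ≤ T) (hp : p ≠ ∞) (S : Submodule ℝ (Lp H p (timeMeasure T)))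
    (hS : IsClosed (S : Set (Lp H p (timeMeasure T))))
    (hmem : ∀ t ∈ Icc 0 T, ∀ x, stepLp T p t x ∈ S) : S = ⊤ := by
  -- A π-λ argument: the sets whose indicators lie in `S` contain the half-lines and are stable
  -- under complements and, `S` being closed, under countable disjoint unions.
  have key : ∀ (s : Set ℝ) (hs : MeasurableSet s) (x : H),
      indicatorConstLp p hs (measure_ne_top (timeMeasure T) _) x ∈ S := by
    intro s hs x
    have huniv : indicatorConstLp p MeasurableSet.univ (measure_ne_top (timeMeasure T) _) x ∈ S := by
      convert hmem T ⟨hT, le_rfl⟩ x using 1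
      refine Lp.ext ((indicatorConstLp_coeFn).trans ?_ |>.trans (coeFn_stepLp T x).symm)
      refine (ae_restrict_iff' measurableSet_Icc).2 ?_
      filter_upwards [compl_mem_ae_iff.2 (measure_singleton (μ := volume) (0 : ℝ))] with u hu hu'
      have : u ∈ Ioc 0 T := ⟨lt_of_le_of_ne hu'.1 (Ne.symm hu), hu'.2⟩
      simp [indicator_of_mem this]
    induction s, hs using MeasurableSpace.induction_on_inter
      (borel_eq_generateFrom_Iic ℝ ▸ BorelSpace.measurable_eq) isPiSystem_Iic with
    | empty => simp
    | basic t ht =>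
      obtain ⟨a, rfl⟩ := ht
      -- Within [0,T], and off the null point 0, the half-line up to a is the interval from 0 to the
      -- value of a clamped to [0,T]; this covers a < 0 and a > T as well.
      convert hmem (projIcc 0 T hT a) (projIcc 0 T hT a).2 x using 1
      refine Lp.ext ((indicatorConstLp_coeFn).trans ?_ |>.trans (coeFn_stepLp _ x).symm)
      refine (ae_restrict_iff' measurableSet_Icc).2 ?_
      filter_upwards [compl_mem_ae_iff.2 (measure_singleton (μ := volume) (0 : ℝ))] with u hu hu'
      have h0 : 0 < u := lt_of_le_of_ne hu'.1 (Ne.symm hu)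
      have : u ∈ Iic a ↔ u ∈ Ioc 0 (projIcc 0 T hT a : ℝ) := by
        simp only [mem_Iic, mem_Ioc, coe_projIcc, le_max_iff, le_min_iff, h0, hu'.2, true_and,
          h0.not_ge, false_or]
      simp only [indicator, this]
    | compl t ht ih =>
      have h := indicatorConstLp_disjoint_union (p := p) (c := x) ht ht.compl
        (measure_ne_top (timeMeasure T) _) (measure_ne_top (timeMeasure T) _) disjoint_compl_right
      have h' : indicatorConstLp p ht.compl (measure_ne_top (timeMeasure T) _) x =
          indicatorConstLp p MeasurableSet.univ (measure_ne_top (timeMeasure T) _) x -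
            indicatorConstLp p ht (measure_ne_top (timeMeasure T) _) x := by
        rw [eq_sub_iff_add_eq, add_comm, ← h]
        congr 1
        exact union_compl_self t
      rw [h']
      exact S.sub_mem huniv ih
    | iUnion f hd hm ih =>
      have hfin : ∀ N : ℕ, indicatorConstLp p (MeasurableSet.iUnion fun i : Fin N => hm i)
          (measure_ne_top (timeMeasure T) _) x ∈ S := by
        intro N
        induction N with
        | zero => simp
        | succ N ihN =>
          have hdis : Disjoint (⋃ i : Fin N, f i) (f N) :=
            disjoint_iUnion_left.2 fun i => hd i.2.ne
          have h := indicatorConstLp_disjoint_union (p := p) (c := x)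
            (MeasurableSet.iUnion fun i : Fin N => hm i) (hm N)
            (measure_ne_top (timeMeasure T) _) (measure_ne_top (timeMeasure T) _) hdis
          have hset : ⋃ i : Fin (N + 1), f i = (⋃ i : Fin N, f i) ∪ f N := by
            ext u
            simp [Fin.exists_fin_succ']
          have h' := h ▸ S.add_mem ihN (ih N)
          convert h' using 2
      refine hS.mem_of_tendsto (b := Filter.atTop) (tendsto_indicatorConstLp_set hp ?_)
        (Filter.Eventually.of_forall hfin)
      have hsub : ∀ N : ℕ, ⋃ i : Fin N, f i ⊆ ⋃ i, f i := fun N =>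
        iUnion_subset fun i => subset_iUnion f i
      have hmono : Monotone fun N : ℕ => ⋃ i : Fin N, f i := fun M N hMN =>
        iUnion_subset fun i => subset_iUnion (fun j : Fin N => f j) ⟨i, i.2.trans_le hMN⟩
      have hU : ⋃ N : ℕ, ⋃ i : Fin N, f i = ⋃ i, f i :=
        subset_antisymm (iUnion_subset hsub) (iUnion_subset fun i => subset_iUnion_of_subset (i + 1)
          (subset_iUnion_of_subset (Fin.last i) (by simp)))
      have hanti : Antitone fun N : ℕ => (⋃ i, f i) \ ⋃ i : Fin N, f i := fun M N hMN =>
        sdiff_subset_sdiff_right (hmono hMN)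
      have hlim := tendsto_measure_iInter_atTop (μ := timeMeasure T)
        (fun N => ((MeasurableSet.iUnion hm).diff
          (MeasurableSet.iUnion fun i : Fin N => hm i)).nullMeasurableSet) hanti
        ⟨0, measure_ne_top _ _⟩
      have h0 : ⋂ N : ℕ, (⋃ i, f i) \ ⋃ i : Fin N, f i = ∅ := by
        rw [← sdiff_iUnion, hU, sdiff_self]
      rw [h0, measure_empty] at hlim
      refine hlim.congr fun N => ?_
      rw [Set.symmDiff_def, sdiff_eq_empty.2 (hsub N), empty_union]
      rfl
  rw [eq_top_iff]
  rintro f -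
  induction f using Lp.induction hp with
  | indicatorConst c hs hμ =>
    rw [Lp.simpleFunc.coe_indicatorConst]
    exact key _ hs c
  | add hf hg _ h1 h2 => exact S.add_mem h1 h2
  | isClosed => exact hS

end StepFunctions

/-! ### Identities checked on step functions -/

section StepExtensionality

variable {T : ℝ} {p : ℝ≥0∞} [Fact (1 ≤ p)] {H G : Type*}
  [NormedAddCommGroup H] [NormedSpace ℝ H]

theorem clm_apply_eq_of_stepLp [NormedAddCommGroup G] [NormedSpace ℝ G] (hT : 0 ≤ T) (hp : p ≠ ∞)
    (A B : Lp H p (timeMeasure T) →L[ℝ] G)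
    (h : ∀ t ∈ Icc 0 T, ∀ x, A (stepLp T p t x) = B (stepLp T p t x))
    (f : Lp H p (timeMeasure T)) : A f = B f := by
  have := eq_top_of_stepLp_mem hT hp (LinearMap.eqLocus A.toLinearMap B.toLinearMap)
    (isClosed_eq A.continuous B.continuous) h
  have hf : f ∈ LinearMap.eqLocus A.toLinearMap B.toLinearMap := this.symm ▸ Submodule.mem_top
  exact hf

/-- Density is used in one variable at a time: first in `k` with a step in the first slot, then in
`f` with `k` arbitrary. -/
theorem inner_apply_eq_of_stepLp [NormedAddCommGroup G] [InnerProductSpace ℝ G]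
    (hT : 0 ≤ T) (hp : p ≠ ∞) (I J : Lp H p (timeMeasure T) →L[ℝ] G)
    (B : Lp H p (timeMeasure T) →L[ℝ] Lp H p (timeMeasure T) →L[ℝ] ℝ)
    (h : ∀ t ∈ Icc 0 T, ∀ s ∈ Icc 0 T, ∀ x y,
      ⟪I (stepLp T p t x), J (stepLp T p s y)⟫ = B (stepLp T p t x) (stepLp T p s y))
    (f k : Lp H p (timeMeasure T)) : ⟪I f, J k⟫ = B f k := by
  have h1 : ∀ t ∈ Icc 0 T, ∀ x, ∀ k, ⟪I (stepLp T p t x), J k⟫ = B (stepLp T p t x) k :=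
    fun t ht x k => clm_apply_eq_of_stepLp hT hp (innerSL ℝ (I (stepLp T p t x)) ∘L J)
      (B (stepLp T p t x)) (fun s hs y => h t ht s hs x y) k
  have h2 := clm_apply_eq_of_stepLp hT hp (innerSL ℝ (J k) ∘L I) (B.flip k)
    (fun t ht x => by
      simpa [real_inner_comm] using h1 t ht x k) f
  simpa [real_inner_comm] using h2

end StepExtensionality

/-! ### The integral with respect to one process -/

section WienerIntegral

variable {Ω : Type*} [MeasurableSpace Ω] {P : Measure Ω}
  {H : Type*} [NormedAddCommGroup H] [InnerProductSpace ℝ H]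
  {T : ℝ} {φ : ℝ → ℝ → ℝ} {p : ℝ≥0∞} [Fact (1 ≤ p)] {g : Icc (0 : ℝ) T → Ω → ℝ}

/-- The element `X x` of `L²(Ω; H)` for `X ∈ L²(Ω)` and `x ∈ H`. -/
def smulLp (X : Lp ℝ 2 P) (x : H) : Lp H 2 P :=
  (ContinuousLinearMap.toSpanSingleton ℝ x).compLpL 2 P X

theorem coeFn_smulLp (X : Lp ℝ 2 P) (x : H) : smulLp X x =ᵐ[P] fun ω => X ω • x :=
  (ContinuousLinearMap.coeFn_compLpL _ X).trans (ae_of_all _ fun ω => by simp)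

theorem inner_smulLp (X Y : Lp ℝ 2 P) (x y : H) :
    ⟪smulLp X x, smulLp Y y⟫ = ⟪x, y⟫ * ∫ ω, X ω * Y ω ∂P := by
  rw [L2.inner_def, ← integral_const_mul]
  refine integral_congr_ae ?_
  filter_upwards [coeFn_smulLp X x, coeFn_smulLp Y y] with ω h1 h2
  rw [h1, h2, real_inner_smul_left, real_inner_smul_right]
  ring

theorem compLpL_smulLp {H' : Type*} [NormedAddCommGroup H'] [InnerProductSpace ℝ H']
    (L : H →L[ℝ] H') (X : Lp ℝ 2 P) (x : H) :
    L.compLpL 2 P (smulLp X x) = smulLp X (L x) := by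
  refine Lp.ext ?_
  filter_upwards [L.coeFn_compLpL (smulLp X x), coeFn_smulLp X x, coeFn_smulLp X (L x)]
    with ω h1 h2 h3
  rw [h1, h2, h3, map_smul]

theorem compLpL_stepLp {H' : Type*} [NormedAddCommGroup H'] [InnerProductSpace ℝ H']
    (L : H →L[ℝ] H') (t : ℝ) (x : H) :
    L.compLpL p (timeMeasure T) (stepLp T p t x) = stepLp T p t (L x) := by
  refine Lp.ext ?_
  filter_upwards [L.coeFn_compLpL (stepLp T p t x), coeFn_stepLp (T := T) (p := p) t x,
    coeFn_stepLp (T := T) (p := p) t (L x)] with ω h1 h2 h3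
  rw [h1, h2, h3]
  by_cases h : ω ∈ Ioc 0 t <;> simp [indicator, h, -mem_Ioc]

/-- The variance R(0,0) vanishes. This allows the increments in `IsWienerIntegral` to be replaced by
the values g(t) attached to the intervals (0,t]. -/
theorem ae_eq_zero_of_cov (hT : 0 ≤ T) (hg : ∀ t, MemLp (g t) 2 P)
    (hR : ∀ t s, ∫ ω, g t ω * g s ω ∂P = kernelCov φ t s) : g ⟨0, le_rfl, hT⟩ =ᵐ[P] 0 := by
  have h := hR ⟨0, le_rfl, hT⟩ ⟨0, le_rfl, hT⟩
  simp only [kernelCov, intervalIntegral.integral_same] at h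
  have h' := (integral_eq_zero_iff_of_nonneg (fun ω => mul_self_nonneg _)
    ((hg _).integrable_mul (hg _))).1 h
  filter_upwards [h'] with ω hω
  simpa using hω

theorem isWienerIntegral_iff (hT : 0 ≤ T) (hg : ∀ t, MemLp (g t) 2 P)
    (hR : ∀ t s, ∫ ω, g t ω * g s ω ∂P = kernelCov φ t s)
    (I : Lp H p (timeMeasure T) →L[ℝ] Lp H 2 P) :
    IsWienerIntegral P p g I ↔
      ∀ (t : Icc (0 : ℝ) T) (x : H), I (stepLp T p t x) = smulLp (hg t).toLp x := by
  have h0 := ae_eq_zero_of_cov hT hg hR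
  constructor
  · intro h t x
    refine Lp.ext ?_
    filter_upwards [h ⟨0, le_rfl, hT⟩ t t.2.1 x, coeFn_smulLp (hg t).toLp x, (hg t).coeFn_toLp, h0]
      with ω h1 h2 h3 h4
    rw [h2, h3]
    refine h1.trans ?_
    rw [h4, Pi.zero_apply, sub_zero]
  · intro h s t hst x
    rw [indicatorConstLp_Ioc_eq_sub s.2.1 hst, map_sub, h, h]
    filter_upwards [Lp.coeFn_sub (smulLp (hg t).toLp x) (smulLp (hg s).toLp x),
      coeFn_smulLp (hg t).toLp x, (hg t).coeFn_toLp, coeFn_smulLp (hg s).toLp x, (hg s).coeFn_toLp]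
      with ω h1 h2 h3 h4 h5
    rw [h1, Pi.sub_apply, h2, h3, h4, h5, sub_smul]

theorem inner_smulLp_toLp {X Y : Ω → ℝ} (hX : MemLp X 2 P) (hY : MemLp Y 2 P) (x y : H) :
    ⟪smulLp hX.toLp x, smulLp hY.toLp y⟫ = ⟪x, y⟫ * ∫ ω, X ω * Y ω ∂P := by
  rw [inner_smulLp]
  congr 1
  refine integral_congr_ae ?_
  filter_upwards [hX.coeFn_toLp, hY.coeFn_toLp] with ω h1 h2
  rw [h1, h2]

omit [Fact (1 ≤ p)] in
theorem kernelForm_stepLp (hφ : KernelCondition T φ p) (t s : Icc (0 : ℝ) T) (x y : H) :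
    kernelForm T φ (stepLp T p t x) (stepLp T p s y) = ⟪x, y⟫ * kernelCov φ t s := by
  rw [kernelForm_congr (coeFn_stepLp _ x) (coeFn_stepLp _ y), hφ.kernelForm_indicator s.2 t.2]

theorem exists_isWienerIntegral [CompleteSpace H] (hT : 0 ≤ T) (hp : p ≠ ∞)
    (hφ : KernelCondition T φ p) (hg : ∀ t, MemLp (g t) 2 P)
    (hR : ∀ t s, ∫ ω, g t ω * g s ω ∂P = kernelCov φ t s) :
    ∃ I : Lp H p (timeMeasure T) →L[ℝ] Lp H 2 P, IsWienerIntegral P p g I := by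
  obtain ⟨B, hB⟩ := hφ.exists_kernelForm_clm (H := H)
  obtain ⟨K, hK0, hK⟩ := hφ.exists_abs_kernelForm_le (H := H)
  -- A step function has many representations, so the integral is defined on formal combinations.
  -- The estimate of `b` by `e` makes it independent of the representation and lets it extend from
  -- the dense range of `e`.
  let e : (Icc (0 : ℝ) T × H →₀ ℝ) →ₗ[ℝ] Lp H p (timeMeasure T) :=
    Finsupp.linearCombination ℝ fun q => stepLp T p q.1 q.2
  let b : (Icc (0 : ℝ) T × H →₀ ℝ) →ₗ[ℝ] Lp H 2 P :=
    Finsupp.linearCombination ℝ fun q => smulLp (hg q.1).toLp q.2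
  have hinner : ∀ ξ, ⟪b ξ, b ξ⟫ = B (e ξ) (e ξ) := by
    intro ξ
    simp only [b, e, Finsupp.linearCombination_apply, Finsupp.sum, sum_inner, inner_sum, map_sum,
      _root_.sum_apply, map_smul, _root_.smul_apply,
      real_inner_smul_left, real_inner_smul_right, smul_eq_mul, inner_smulLp_toLp, hB,
      kernelForm_stepLp hφ, hR]
    simp only [Finset.mul_sum]
  have hnorm : ∀ ξ, ‖b ξ‖ ≤ √K * ‖e ξ‖ := by
    intro ξ
    refine abs_le_of_sq_le_sq' ?_ (by positivity) |>.2
    rw [mul_pow, Real.sq_sqrt hK0, ← real_inner_self_eq_norm_sq, hinner, hB]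
    exact (le_abs_self _).trans ((hK _ _).trans_eq (by ring))
  have hdense : DenseRange e := by
    have := eq_top_of_stepLp_mem hT hp (LinearMap.range e).topologicalClosure
      (Submodule.isClosed_topologicalClosure _) fun t ht x =>
        Submodule.le_topologicalClosure _ ⟨Finsupp.single (⟨t, ht⟩, x) 1, by simp [e]⟩
    intro f
    have hf : f ∈ (LinearMap.range e).topologicalClosure := this ▸ Submodule.mem_top
    exact hf
  refine ⟨b.extendOfNorm e, (isWienerIntegral_iff hT hg hR _).2 fun t x => ?_⟩
  have := LinearMap.extendOfNorm_eq hdense ⟨_, hnorm⟩ (Finsupp.single (t, x) 1)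
  simpa [e, b] using this

namespace IsWienerIntegral

variable {I : Lp H p (timeMeasure T) →L[ℝ] Lp H 2 P}

theorem eq (hT : 0 ≤ T) (hp : p ≠ ∞) (hg : ∀ t, MemLp (g t) 2 P)
    (hR : ∀ t s, ∫ ω, g t ω * g s ω ∂P = kernelCov φ t s)
    (hI : IsWienerIntegral P p g I) {J : Lp H p (timeMeasure T) →L[ℝ] Lp H 2 P}
    (hJ : IsWienerIntegral P p g J) : I = J := by
  rw [isWienerIntegral_iff hT hg hR] at hI hJ
  exact ContinuousLinearMap.ext fun f => clm_apply_eq_of_stepLp hT hp I J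
    (fun t ht x => (hI ⟨t, ht⟩ x).trans (hJ ⟨t, ht⟩ x).symm) f

theorem inner_eq (hT : 0 ≤ T) (hp : p ≠ ∞) (hφ : KernelCondition T φ p)
    (hg : ∀ t, MemLp (g t) 2 P) (hR : ∀ t s, ∫ ω, g t ω * g s ω ∂P = kernelCov φ t s)
    (hI : IsWienerIntegral P p g I) (f k : Lp H p (timeMeasure T)) :
    ⟪I f, I k⟫ = kernelForm T φ f k := by
  rw [isWienerIntegral_iff hT hg hR] at hI
  obtain ⟨B, hB⟩ := hφ.exists_kernelForm_clm (H := H)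
  rw [← hB]
  refine inner_apply_eq_of_stepLp hT hp I I B (fun t ht s hs x y => ?_) f k
  rw [hI ⟨t, ht⟩, hI ⟨s, hs⟩, inner_smulLp_toLp, hR, hB, kernelForm_stepLp hφ ⟨t, ht⟩ ⟨s, hs⟩]

theorem inner_eq_zero {g' : Icc (0 : ℝ) T → Ω → ℝ} {J : Lp H p (timeMeasure T) →L[ℝ] Lp H 2 P}
    (hT : 0 ≤ T) (hp : p ≠ ∞) (hg : ∀ t, MemLp (g t) 2 P)
    (hR : ∀ t s, ∫ ω, g t ω * g s ω ∂P = kernelCov φ t s) (hg' : ∀ t, MemLp (g' t) 2 P)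
    (hR' : ∀ t s, ∫ ω, g' t ω * g' s ω ∂P = kernelCov φ t s)
    (horth : ∀ t s, ∫ ω, g t ω * g' s ω ∂P = 0)
    (hI : IsWienerIntegral P p g I) (hJ : IsWienerIntegral P p g' J)
    (f k : Lp H p (timeMeasure T)) : ⟪I f, J k⟫ = 0 := by
  rw [isWienerIntegral_iff hT hg hR] at hI
  rw [isWienerIntegral_iff hT hg' hR'] at hJ
  refine inner_apply_eq_of_stepLp hT hp I J 0 (fun t ht s hs x y => ?_) f k
  rw [hI ⟨t, ht⟩, hJ ⟨s, hs⟩, inner_smulLp_toLp, horth]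
  simp

/-- Both sides are continuous in `f` and agree on steps. With H' = ℝ this reduces the weak
covariance formula to real-valued integrals. -/
theorem compLpL_apply {H' : Type*} [NormedAddCommGroup H'] [InnerProductSpace ℝ H']
    {J : Lp H' p (timeMeasure T) →L[ℝ] Lp H' 2 P} (hT : 0 ≤ T) (hp : p ≠ ∞)
    (hg : ∀ t, MemLp (g t) 2 P) (hR : ∀ t s, ∫ ω, g t ω * g s ω ∂P = kernelCov φ t s)
    (hI : IsWienerIntegral P p g I) (hJ : IsWienerIntegral P p g J) (L : H →L[ℝ] H')
    (f : Lp H p (timeMeasure T)) :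
    L.compLpL 2 P (I f) = J (L.compLpL p (timeMeasure T) f) := by
  rw [isWienerIntegral_iff hT hg hR] at hI hJ
  refine clm_apply_eq_of_stepLp hT hp (L.compLpL 2 P ∘L I) (J ∘L L.compLpL p (timeMeasure T))
    (fun t ht x => ?_) f
  rw [ContinuousLinearMap.comp_apply, ContinuousLinearMap.comp_apply, hI ⟨t, ht⟩, compLpL_stepLp,
    hJ ⟨t, ht⟩, compLpL_smulLp]

theorem compLpL_inner_mem {G : Submodule ℝ (Lp ℝ 2 P)} (hG : IsClosed (G : Set (Lp ℝ 2 P)))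
    (hT : 0 ≤ T) (hp : p ≠ ∞) (hg : ∀ t, MemLp (g t) 2 P)
    (hR : ∀ t s, ∫ ω, g t ω * g s ω ∂P = kernelCov φ t s)
    (hmem : ∀ t, (hg t).toLp ∈ G) (hI : IsWienerIntegral P p g I) (L : H →L[ℝ] ℝ)
    (f : Lp H p (timeMeasure T)) : L.compLpL 2 P (I f) ∈ G := by
  rw [isWienerIntegral_iff hT hg hR] at hI
  have := eq_top_of_stepLp_mem hT hp (G.comap (L.compLpL 2 P ∘L I).toLinearMap)
    (hG.preimage (L.compLpL 2 P ∘L I).continuous) fun t ht x => by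
      rw [Submodule.mem_comap, ContinuousLinearMap.coe_coe, ContinuousLinearMap.comp_apply,
        hI ⟨t, ht⟩, compLpL_smulLp]
      have h : smulLp (hg ⟨t, ht⟩).toLp (L x) = L x • (hg ⟨t, ht⟩).toLp := by
        refine Lp.ext ?_
        filter_upwards [coeFn_smulLp (hg ⟨t, ht⟩).toLp (L x),
          Lp.coeFn_smul (L x) (hg ⟨t, ht⟩).toLp] with ω h1 h2
        rw [h1, h2, Pi.smul_apply, smul_eq_mul, smul_eq_mul, mul_comm]
      rw [h]
      exact G.smul_mem _ (hmem _)
  have hf : f ∈ G.comap (L.compLpL 2 P ∘L I).toLinearMap := this.symm ▸ Submodule.mem_top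
  exact hf

end IsWienerIntegral

/-- The constant is chosen before the process, hence serves all g_n at once; the convergence of the
series for `G` rests on this. -/
theorem exists_norm_isWienerIntegral_le (hT : 0 ≤ T) (hp : p ≠ ∞) (hφ : KernelCondition T φ p) :
    ∃ C : ℝ, 0 ≤ C ∧ ∀ (g : Icc (0 : ℝ) T → Ω → ℝ), (∀ t, MemLp (g t) 2 P) →
      (∀ t s, ∫ ω, g t ω * g s ω ∂P = kernelCov φ t s) →
      ∀ I : Lp H p (timeMeasure T) →L[ℝ] Lp H 2 P, IsWienerIntegral P p g I →
        ∀ f, ‖I f‖ ≤ C * ‖f‖ := by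
  obtain ⟨K, hK0, hK⟩ := hφ.exists_abs_kernelForm_le (H := H)
  refine ⟨√K, Real.sqrt_nonneg _, fun g hg hR I hI f => ?_⟩
  refine abs_le_of_sq_le_sq' ?_ (by positivity) |>.2
  rw [mul_pow, Real.sq_sqrt hK0, ← real_inner_self_eq_norm_sq,
    hI.inner_eq hT hp hφ hg hR]
  exact (le_abs_self _).trans ((hK _ _).trans_eq (by ring))

end WienerIntegral

/-! ### The Gaussian space spanned by the processes -/

section GaussianSpace

variable {Ω : Type*} [MeasurableSpace Ω] {P : Measure Ω} [IsProbabilityMeasure P]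

theorem norm_cexp_ofReal_mul_I_sub_le (a b : ℝ) :
    ‖Complex.exp (a * Complex.I) - Complex.exp (b * Complex.I)‖ ≤ |a - b| := by
  have h : Complex.exp (a * Complex.I) - Complex.exp (b * Complex.I) =
      Complex.exp (b * Complex.I) * (Complex.exp (Complex.I * (a - b : ℝ)) - 1) := by
    rw [mul_sub, ← Complex.exp_add, mul_one]
    congr 2
    push_cast
    ring
  rw [h, norm_mul, Complex.norm_exp_ofReal_mul_I, one_mul]
  exact Real.norm_exp_I_mul_ofReal_sub_one_le

theorem integral_abs_le_norm_Lp_two (X : Lp ℝ 2 P) : ∫ ω, |X ω| ∂P ≤ ‖X‖ := by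
  have h := eLpNorm_le_eLpNorm_of_exponent_le (μ := P) (p := 1) (q := 2) (by norm_num)
    (Lp.aestronglyMeasurable X)
  have h1 : ∫ ω, |X ω| ∂P = (eLpNorm X 1 P).toReal := by
    rw [eLpNorm_one_eq_lintegral_enorm, ← integral_norm_eq_lintegral_enorm
      (Lp.aestronglyMeasurable X)]
    rfl
  rw [h1, Lp.norm_def]
  exact ENNReal.toReal_mono (Lp.eLpNorm_ne_top X) h

theorem integrable_coeFn_Lp_two (X : Lp ℝ 2 P) : Integrable X P :=
  (Lp.memLp X).integrable (by norm_num)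

theorem integrable_cexp_ofReal_mul_I {X : Ω → ℝ} (hX : AEStronglyMeasurable X P) :
    Integrable (fun ω => Complex.exp (X ω * Complex.I)) P := by
  refine Integrable.of_bound (C := 1) ?_ (ae_of_all _ fun ω => ?_)
  · exact (by fun_prop : Continuous fun x : ℝ => Complex.exp (x * Complex.I)).comp_aestronglyMeasurable
      hX
  · rw [Complex.norm_exp_ofReal_mul_I]

omit [IsProbabilityMeasure P] in
theorem charFun_map_Lp (X : Lp ℝ 2 P) (t : ℝ) :
    charFun (P.map X) t = ∫ ω, Complex.exp ((t * X ω : ℝ) * Complex.I) ∂P := by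
  rw [charFun_apply_real, integral_map (Lp.aestronglyMeasurable X).aemeasurable (by fun_prop)]
  push_cast
  rfl

/-- Since |e^{ia} - e^{ib}| ≤ |a - b| and the L¹ norm is at most the L² norm, the map is Lipschitz
with constant |t|. -/
theorem continuous_charFun_map_Lp (t : ℝ) :
    Continuous fun X : Lp ℝ 2 P => charFun (P.map X) t := by
  refine (LipschitzWith.of_dist_le_mul (K := ‖t‖₊) fun X Y => ?_).continuous
  have hm : ∀ X : Lp ℝ 2 P, Integrable (fun ω => Complex.exp ((t * X ω : ℝ) * Complex.I)) P :=
    fun X => integrable_cexp_ofReal_mul_I ((Lp.aestronglyMeasurable X).const_mul t)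
  rw [dist_eq_norm, dist_eq_norm, charFun_map_Lp, charFun_map_Lp, ← integral_sub (hm X) (hm Y)]
  calc _ ≤ ∫ ω, ‖Complex.exp ((t * X ω : ℝ) * Complex.I) -
        Complex.exp ((t * Y ω : ℝ) * Complex.I)‖ ∂P := norm_integral_le_integral_norm _
    _ ≤ ∫ ω, |t| * |(X - Y : Lp ℝ 2 P) ω| ∂P := by
      refine integral_mono_ae ((hm X).sub (hm Y)).norm
        ((integrable_coeFn_Lp_two (X - Y)).abs.const_mul _) ?_
      filter_upwards [Lp.coeFn_sub X Y] with ω h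
      rw [h, Pi.sub_apply, ← abs_mul, mul_sub]
      exact norm_cexp_ofReal_mul_I_sub_le _ _
    _ ≤ |t| * ‖X - Y‖ := by
      rw [integral_const_mul]
      gcongr
      exact integral_abs_le_norm_Lp_two _

/-- `L²` limits of centred Gaussian variables are centred Gaussian. -/
theorem isClosed_setOf_map_eq_gaussianReal :
    IsClosed {X : Lp ℝ 2 P | P.map X = gaussianReal 0 (‖X‖₊ ^ 2)} := by
  -- Characteristic functions determine laws, so the set is cut out by one equation for each t, with
  -- both sides continuous in X. Taking ‖X‖² as the variance makes the limit variance automatic.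
  have h : {X : Lp ℝ 2 P | P.map X = gaussianReal 0 (‖X‖₊ ^ 2)} =
      ⋂ t : ℝ, {X : Lp ℝ 2 P | charFun (P.map X) t =
        Complex.exp (-(((‖X‖ ^ 2 * t ^ 2 / 2 : ℝ)) : ℂ))} := by
    ext X
    have : IsProbabilityMeasure (P.map X) :=
      Measure.isProbabilityMeasure_map (Lp.aestronglyMeasurable X).aemeasurable
    have hc : ∀ t : ℝ, charFun (gaussianReal 0 (‖X‖₊ ^ 2)) t =
        Complex.exp (-(((‖X‖ ^ 2 * t ^ 2 / 2 : ℝ)) : ℂ)) := by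
      intro t
      rw [charFun_gaussianReal]
      congr 1
      push_cast
      simp
    simp only [mem_ofPred_eq, mem_iInter]
    constructor
    · intro hX t
      rw [hX, hc]
    · intro hX
      refine Measure.ext_of_charFun (funext fun t => ?_)
      rw [hX, hc]
  rw [h]
  refine isClosed_iInter fun t => isClosed_eq (continuous_charFun_map_Lp t) ?_
  fun_prop

omit [IsProbabilityMeasure P] in
theorem map_eq_gaussianReal_of_hasGaussianLaw {X : Lp ℝ 2 P} (hX : HasGaussianLaw X P)
    (h0 : ∫ ω, X ω ∂P = 0) : P.map X = gaussianReal 0 (‖X‖₊ ^ 2) := by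
  rw [hX.map_eq_gaussianReal, h0, variance_of_integral_eq_zero hX.aemeasurable h0]
  congr 1
  ext
  rw [Real.coe_toNNReal _ (integral_nonneg fun ω => sq_nonneg _), NNReal.coe_pow, coe_nnnorm,
    ← real_inner_self_eq_norm_sq, L2.inner_def]
  simp [sq]

variable {ι κ : Type*} {g : ι → κ → Ω → ℝ}

omit [IsProbabilityMeasure P] in
-- A finite set of index pairs sits in a finite rectangle N × S. Over the rectangle the rows are
-- independent Gaussian vectors, hence jointly Gaussian, and the wanted family is a coordinate
-- projection.
theorem isGaussianProcess_of_iIndepFun (hg : ∀ n, IsGaussianProcess (g n) P)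
    (hind : iIndepFun (fun n ω t => g n t ω) P) :
    IsGaussianProcess (fun (q : ι × κ) ω => g q.1 q.2 ω) P := by
  classical
  refine ⟨fun I => ?_⟩
  let N := I.image Prod.fst
  let S := I.image Prod.snd
  have hind' : iIndepFun (fun (n : N) ω => S.restrict (fun t => g n t ω)) P :=
    (hind.precomp (g := fun n : N => (n : ι)) Subtype.val_injective).comp
      (fun _ path => S.restrict path) fun _ => Finset.measurable_restrict S
  have hlaw := hind'.hasGaussianLaw fun n : N => (hg n).hasGaussianLaw S
  let L : (N → S → ℝ) →L[ℝ] (I → ℝ) := ContinuousLinearMap.pi fun q =>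
    (ContinuousLinearMap.proj (R := ℝ) (φ := fun _ : S => ℝ)
      ⟨q.1.2, Finset.mem_image_of_mem _ q.2⟩) ∘L
    (ContinuousLinearMap.proj (R := ℝ) (φ := fun _ : N => S → ℝ)
      ⟨q.1.1, Finset.mem_image_of_mem _ q.2⟩)
  exact hlaw.map_fun L

/-- The closed linear span of independent centred Gaussian processes consists of centred Gaussian
variables. -/
theorem exists_gaussianSpace (hg : ∀ n, IsGaussianProcess (g n) P)
    (hmean : ∀ n t, ∫ ω, g n t ω ∂P = 0) (hind : iIndepFun (fun n ω t => g n t ω) P)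
    (hg2 : ∀ n t, MemLp (g n t) 2 P) :
    ∃ G : Submodule ℝ (Lp ℝ 2 P), IsClosed (G : Set (Lp ℝ 2 P)) ∧
      (∀ n t, (hg2 n t).toLp ∈ G) ∧ ∀ X ∈ G, P.map X = gaussianReal 0 (‖X‖₊ ^ 2) := by
  let v : ι × κ → Lp ℝ 2 P := fun q => (hg2 q.1 q.2).toLp
  refine ⟨(Submodule.span ℝ (range v)).topologicalClosure, Submodule.isClosed_topologicalClosure _,
    fun n t => Submodule.le_topologicalClosure _ (Submodule.subset_span ⟨(n, t), rfl⟩), ?_⟩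
  suffices h : ((Submodule.span ℝ (range v) : Submodule ℝ (Lp ℝ 2 P)) : Set (Lp ℝ 2 P)) ⊆
      {X : Lp ℝ 2 P | P.map X = gaussianReal 0 (‖X‖₊ ^ 2)} by
    intro X hX
    exact closure_minimal h isClosed_setOf_map_eq_gaussianReal hX
  intro X hX
  obtain ⟨ξ, rfl⟩ := (Finsupp.mem_span_range_iff_exists_finsupp).1 hX
  have hae : (fun ω => ∑ q : ξ.support, ξ q * g q.1.1 q.1.2 ω) =ᵐ[P]
      (ξ.sum fun q a => a • v q : Lp ℝ 2 P) := by
    rw [Finsupp.sum, ← Finset.sum_coe_sort]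
    refine Filter.EventuallyEq.symm ((Lp.coeFn_finsetSum _ _).trans ?_)
    have h1 : ∀ᵐ ω ∂P, ∀ q : ξ.support, (ξ q • v q : Lp ℝ 2 P) ω = ξ q * g q.1.1 q.1.2 ω := by
      refine ae_all_iff.2 fun q => ?_
      filter_upwards [Lp.coeFn_smul (ξ q) (v q), (hg2 q.1.1 q.1.2).coeFn_toLp] with ω h1 h2
      rw [h1, Pi.smul_apply, h2, smul_eq_mul]
    filter_upwards [h1] with ω hω
    simp [hω]
  have hlaw := (((isGaussianProcess_of_iIndepFun hg hind).hasGaussianLaw ξ.support).map_fun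
    (∑ q : ξ.support, ξ q • ContinuousLinearMap.proj (R := ℝ) (φ := fun _ : ξ.support => ℝ) q))
  refine map_eq_gaussianReal_of_hasGaussianLaw (hlaw.congr ?_) ?_
  · refine Filter.EventuallyEq.trans (ae_of_all _ fun ω => ?_) hae
    simp [_root_.sum_apply]
  · rw [← integral_congr_ae hae, integral_finsetSum _ fun q _ =>
      ((hg2 q.1.1 q.1.2).integrable (by norm_num)).const_mul _]
    simp [integral_const_mul, hmean]

variable {H : Type*} [NormedAddCommGroup H] [InnerProductSpace ℝ H] [MeasurableSpace H]
  [BorelSpace H] [SecondCountableTopology H]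

omit [IsProbabilityMeasure P] in
-- Cramér–Wold: a continuous functional on a finite power of H is a sum of functionals of the
-- coordinates, so it sends the vector into `G`, where all laws are Gaussian.
theorem isGaussianProcess_of_compLpL_map_eq {X : κ → Lp H 2 P} {G : Submodule ℝ (Lp ℝ 2 P)}
    (hG : ∀ Y ∈ G, P.map Y = gaussianReal 0 (‖Y‖₊ ^ 2))
    (hX : ∀ i (L : H →L[ℝ] ℝ), L.compLpL 2 P (X i) ∈ G) :
    IsGaussianProcess (fun i ω => X i ω) P := by
  classical
  refine ⟨fun I => ⟨isGaussian_of_map_eq_gaussianReal fun L => ?_⟩⟩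
  have hmeas : AEMeasurable (fun ω => I.restrict (fun i => X i ω)) P :=
    aemeasurable_pi_lambda _ fun i => (Lp.aestronglyMeasurable (X i)).aemeasurable
  rw [AEMeasurable.map_map_of_aemeasurable (by fun_prop) hmeas]
  let Y : Lp ℝ 2 P := ∑ i : I, (L ∘L ContinuousLinearMap.single ℝ (fun _ : I => H) i).compLpL 2 P (X i)
  have hY : Y ∈ G := G.sum_mem fun i _ => hX i _
  have hae : L ∘ (fun ω => I.restrict (fun i => X i ω)) =ᵐ[P] Y := by
    refine Filter.EventuallyEq.symm ((Lp.coeFn_finsetSum _ _).trans ?_)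
    have h1 : ∀ᵐ ω ∂P, ∀ i : I,
        ((L ∘L ContinuousLinearMap.single ℝ (fun _ : I => H) i).compLpL 2 P (X i)) ω =
          L (Pi.single i (X i ω)) :=
      ae_all_iff.2 fun i => by
        filter_upwards [(L ∘L ContinuousLinearMap.single ℝ (fun _ : I => H) i).coeFn_compLpL (X i)]
          with ω h
        rw [h]
        rfl
    filter_upwards [h1] with ω hω
    rw [Finset.sum_apply, Function.comp_apply]
    simp_rw [hω]
    rw [← map_sum]
    congr 1
    exact Finset.univ_sum_single (fun i : I => X i ω)
  exact ⟨_, _, (Measure.map_congr hae).trans (hG Y hY)⟩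

end GaussianSpace

/-! ### Interpolation from a finite net -/

section MetricInterpolation

variable {α E : Type*} [PseudoMetricSpace α] [NormedAddCommGroup E] [NormedSpace ℝ E]

/-- The partition of unity `t ↦ (r - d(t, a))⁺ / ∑_b (r - d(t, b))⁺` attached to an `r`-net `A`. -/
def netWeight (A : Finset α) (r : ℝ) (a t : α) : ℝ :=
  max 0 (r - dist t a) / ∑ b ∈ A, max 0 (r - dist t b)

/-- The interpolation of the values of `x` on the net `A`. -/
def netInterp (A : Finset α) (r : ℝ) (x : α → E) (t : α) : E :=
  ∑ a ∈ A, netWeight A r a t • x a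

variable {A : Finset α} {r : ℝ}

theorem sum_max_pos (hA : ∀ t, ∃ a ∈ A, dist t a < r) (t : α) :
    0 < ∑ b ∈ A, max 0 (r - dist t b) := by
  obtain ⟨a, ha, hd⟩ := hA t
  exact Finset.sum_pos' (fun b _ => le_max_left _ _) ⟨a, ha, lt_max_of_lt_right (sub_pos.2 hd)⟩

theorem continuous_netInterp (hA : ∀ t, ∃ a ∈ A, dist t a < r) (x : α → E) :
    Continuous (netInterp A r x) := by
  refine continuous_finsetSum _ fun a _ => Continuous.smul ?_ continuous_const
  exact Continuous.div (by fun_prop) (by fun_prop) fun t => (sum_max_pos hA t).ne'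

/-- The interpolated value is a convex combination of the x(a) with a within r of t, and balls
around y are convex. -/
theorem norm_netInterp_sub_le (hA : ∀ t, ∃ a ∈ A, dist t a < r) (x : α → E) (t : α) (y : E) {B : ℝ}
    (h : ∀ a ∈ A, dist t a < r → ‖x a - y‖ ≤ B) : ‖netInterp A r x t - y‖ ≤ B := by
  have hpos := sum_max_pos hA t
  have h0 : ∀ a, 0 ≤ netWeight A r a t := fun a => div_nonneg (le_max_left _ _) hpos.le
  have h1 : ∑ a ∈ A, netWeight A r a t = 1 := by
    simp only [netWeight]
    rw [← Finset.sum_div, div_self hpos.ne']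
  have h2 : netInterp A r x t - y = ∑ a ∈ A, netWeight A r a t • (x a - y) := by
    simp only [netInterp, smul_sub, Finset.sum_sub_distrib]
    rw [← Finset.sum_smul, h1, one_smul]
  rw [h2]
  calc _ ≤ ∑ a ∈ A, netWeight A r a t * B := by
        refine norm_sum_le_of_le _ fun a ha => ?_
        rw [norm_smul, Real.norm_of_nonneg (h0 a)]
        by_cases hd : dist t a < r
        · exact mul_le_mul_of_nonneg_left (h a ha hd) (h0 a)
        · have : netWeight A r a t = 0 := by
            rw [netWeight, max_eq_left (by linarith), zero_div]
          simp [this]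
    _ = B := by rw [← Finset.sum_mul, h1, one_mul]

end MetricInterpolation

/-! ### A Kolmogorov continuity criterion -/

section Continuity

variable {α E Ω : Type*} [PseudoMetricSpace α] [NormedAddCommGroup E] [NormedSpace ℝ E]
  [CompleteSpace E] [MeasurableSpace Ω] {P : Measure Ω}

omit [NormedSpace ℝ E] [CompleteSpace E] in
theorem norm_le_rpow_of_enorm_pow_le {x : E} {q : ℕ} (hq : q ≠ 0) {S : ℝ≥0∞} (hS : S ≠ ∞)
    (h : ‖x‖ₑ ^ q ≤ S) : ‖x‖ ≤ S.toReal ^ (1 / q : ℝ) := by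
  have h1 : ‖x‖ ^ q ≤ S.toReal := by
    rw [← toReal_enorm, ← ENNReal.toReal_pow]
    exact ENNReal.toReal_mono hS h
  rw [one_div, Real.le_rpow_inv_iff_of_pos (norm_nonneg _) ENNReal.toReal_nonneg (by positivity),
    Real.rpow_natCast]
  exact h1

/-- A Kolmogorov continuity criterion on a space with nets of geometric size. -/
theorem exists_continuous_modification (X : α → Ω → E) (hX : ∀ t, StronglyMeasurable (X t))
    (A : ℕ → Finset α) (c : ℝ) (hcard : ∀ n, (A n).card ≤ 2 ^ (n + 1))
    (hnet : ∀ n t, ∃ a ∈ A n, dist t a < c * (1 / 2) ^ n) {q : ℕ} (hq : q ≠ 0) {M : ℝ≥0∞}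
    (hM : M ≠ ∞) (hmom : ∀ s t, ∫⁻ ω, ‖X s ω - X t ω‖ₑ ^ q ∂P ≤ M * edist s t ^ 4) :
    ∃ Y : α → Ω → E, (∀ t, StronglyMeasurable (Y t)) ∧ (∀ t, Y t =ᵐ[P] X t) ∧
      ∀ ω, Continuous fun t => Y t ω := by
  classical
  set r : ℕ → ℝ := fun n => c * (1 / 2) ^ n with hr
  let Z : ℕ → α → Ω → E := fun n t ω => netInterp (A n) (r n) (fun a => X a ω) t
  have hZm : ∀ n t, StronglyMeasurable (Z n t) := fun n t =>
    Finset.stronglyMeasurable_fun_sum _ fun a _ => (hX a).const_smul _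
  have hdm : ∀ s t, Measurable fun ω => ‖X s ω - X t ω‖ₑ ^ q := fun s t =>
    ((hX s).sub (hX t)).enorm.pow_const q
  -- A sum over all nearby pairs replaces a maximum of increments between consecutive nets: it
  -- dominates each term and its mean is computable.
  let S : ℕ → Ω → ℝ≥0∞ := fun n ω => ∑ a ∈ A n, ∑ b ∈ A (n + 1) with dist a b < 2 * r n,
    ‖X a ω - X b ω‖ₑ ^ q
  have hSm : ∀ n, Measurable (S n) := fun n =>
    Finset.measurable_fun_sum _ fun a _ => Finset.measurable_fun_sum _ fun b _ => hdm a b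
  let K : Ω → ℝ≥0∞ := fun ω => ∑' n, 2 ^ n * S n ω
  have hKm : Measurable K := Measurable.tsum fun n => (hSm n).const_mul _
  have hedist : ∀ n s t, dist s t < 2 * r n →
      ∫⁻ ω, ‖X s ω - X t ω‖ₑ ^ q ∂P ≤ M * (ENNReal.ofReal (2 * c) * 2⁻¹ ^ n) ^ 4 := by
    intro n s t hst
    refine (hmom s t).trans ?_
    gcongr
    have h2 : (2⁻¹ : ℝ≥0∞) ^ n = ENNReal.ofReal ((1 / 2) ^ n) := by
      rw [ENNReal.ofReal_pow (by norm_num), one_div, ENNReal.ofReal_inv_of_pos (by norm_num)]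
      norm_num
    rw [edist_dist, h2, ← ENNReal.ofReal_mul' (by positivity)]
    exact ENNReal.ofReal_le_ofReal (by rw [mul_assoc]; exact hst.le)
  have hgeom : ∑' n : ℕ, (2⁻¹ : ℝ≥0∞) ^ n ≠ ∞ := by
    rw [ENNReal.tsum_geometric]
    simp
  have h22 : (2 : ℝ≥0∞) * 2⁻¹ = 1 := ENNReal.mul_inv_cancel (by simp) (by simp)
  set M' : ℝ≥0∞ := M * ENNReal.ofReal (2 * c) ^ 4 with hM'
  have hM'_top : M' ≠ ∞ := ENNReal.mul_ne_top hM (ENNReal.pow_ne_top ENNReal.ofReal_ne_top)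
  -- The exponent 4 of the moment bound pays for the weight 2^n and the two net sizes 2^{n+1} and
  -- 2^{n+2}, and one factor 2^{-n} is left for summability.
  have hSint : ∀ n, ∫⁻ ω, 2 ^ n * S n ω ∂P ≤ 8 * M' * 2⁻¹ ^ n := by
    intro n
    have hcard' : ∀ n, ((A n).card : ℝ≥0∞) ≤ 2 ^ (n + 1) := fun n => by exact_mod_cast hcard n
    rw [lintegral_const_mul _ (hSm n), lintegral_finsetSum _ fun a _ =>
      Finset.measurable_fun_sum _ fun b _ => hdm a b]
    simp_rw [lintegral_finsetSum _ fun b _ => hdm _ b]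
    calc _ ≤ 2 ^ n * ∑ a ∈ A n, ∑ b ∈ A (n + 1) with dist a b < 2 * r n,
          M * (ENNReal.ofReal (2 * c) * 2⁻¹ ^ n) ^ 4 := by
          gcongr with a ha b hb
          exact hedist n a b (Finset.mem_filter.1 hb).2
      _ ≤ 2 ^ n * ∑ a ∈ A n, ∑ b ∈ A (n + 1), M * (ENNReal.ofReal (2 * c) * 2⁻¹ ^ n) ^ 4 := by
          gcongr with a ha
          exact Finset.filter_subset _ _
      _ = 2 ^ n * ((A n).card * ((A (n + 1)).card * (M * (ENNReal.ofReal (2 * c) * 2⁻¹ ^ n) ^ 4))) := by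
          simp only [Finset.sum_const, nsmul_eq_mul]
      _ ≤ 2 ^ n * (2 ^ (n + 1) * (2 ^ (n + 1 + 1) *
            (M * (ENNReal.ofReal (2 * c) * 2⁻¹ ^ n) ^ 4))) := by
          gcongr <;> exact hcard' _
      _ = 8 * M' * 2⁻¹ ^ n * (2 * 2⁻¹) ^ n * (2 * 2⁻¹) ^ n * (2 * 2⁻¹) ^ n := by
          rw [hM']
          simp only [mul_pow, pow_succ, pow_zero, one_mul]
          ring
      _ = _ := by rw [h22]; simp
  have hKint : ∫⁻ ω, K ω ∂P ≠ ∞ := by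
    rw [lintegral_tsum fun n => ((hSm n).const_mul _).aemeasurable]
    refine ne_top_of_le_ne_top ?_ (ENNReal.tsum_le_tsum hSint)
    rw [ENNReal.tsum_mul_left]
    exact ENNReal.mul_ne_top (ENNReal.mul_ne_top (by simp) hM'_top) hgeom
  let good : Set Ω := {ω | K ω ≠ ∞}
  have hgood : MeasurableSet good := (hKm (measurableSet_singleton ∞)).compl
  have hgood_ae : ∀ᵐ ω ∂P, ω ∈ good :=
    (ae_lt_top hKm hKint).mono fun ω h => h.ne
  -- Where K is finite, S_n ≤ K 2^{-n}; the q-th root turns this into geometric decay with ratio ρ,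
  -- uniformly in t.
  set ρ : ℝ := (1 / 2 : ℝ) ^ (1 / q : ℝ) with hρ
  have hρ1 : ρ < 1 := Real.rpow_lt_one (by norm_num) (by norm_num) (by positivity)
  have hrpos : ∀ n (t : α), 0 < r n := fun n t => by
    obtain ⟨a, -, ha⟩ := hnet n t
    exact dist_nonneg.trans_lt ha
  have hstep : ∀ ω ∈ good, ∀ n t,
      dist (Z n t ω) (Z (n + 1) t ω) ≤ (K ω).toReal ^ (1 / q : ℝ) * ρ ^ n := by
    intro ω hω n t
    have hKS : S n ω ≤ K ω * 2⁻¹ ^ n := by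
      have h1 : 2 ^ n * S n ω ≤ K ω := ENNReal.le_tsum n
      calc S n ω = 2 ^ n * S n ω * 2⁻¹ ^ n := by
            rw [mul_right_comm, ← mul_pow, h22, one_pow, one_mul]
        _ ≤ _ := by gcongr
    have htop : K ω * 2⁻¹ ^ n ≠ ∞ := ENNReal.mul_ne_top hω (by simp)
    have heq : (K ω * 2⁻¹ ^ n).toReal ^ (1 / q : ℝ) = (K ω).toReal ^ (1 / q : ℝ) * ρ ^ n := by
      rw [ENNReal.toReal_mul, Real.mul_rpow ENNReal.toReal_nonneg ENNReal.toReal_nonneg,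
        ENNReal.toReal_pow, ENNReal.toReal_inv, hρ, ← Real.rpow_natCast, ← Real.rpow_natCast,
        ← Real.rpow_mul (by positivity), ← Real.rpow_mul (by positivity), mul_comm (n : ℝ)]
      norm_num
    rw [← heq, dist_eq_norm]
    refine norm_netInterp_sub_le (hnet n) _ t _ fun a ha hta => ?_
    rw [norm_sub_rev]
    refine norm_netInterp_sub_le (hnet (n + 1)) _ t _ fun b hb htb => ?_
    refine norm_le_rpow_of_enorm_pow_le hq htop (le_trans ?_ hKS)
    rw [← enorm_neg, neg_sub]
    have hab : dist a b < 2 * r n := by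
      have h1 : r (n + 1) = r n / 2 := by simp only [hr, pow_succ]; ring
      have h2 := dist_triangle_left a b t
      have h3 := hrpos n t
      change dist t b < r (n + 1) at htb
      change dist t a < r n at hta
      linarith
    exact (Finset.single_le_sum (f := fun b => ‖X a ω - X b ω‖ₑ ^ q) (fun _ _ => zero_le)
      (Finset.mem_filter.2 ⟨hb, hab⟩)).trans (Finset.single_le_sum
        (f := fun a => ∑ b ∈ A (n + 1) with dist a b < 2 * r n, ‖X a ω - X b ω‖ₑ ^ q)
        (fun _ _ => zero_le) ha)
  have hlim : ∀ ω ∈ good, ∀ t, ∃ y, Filter.Tendsto (fun n => Z n t ω) Filter.atTop (nhds y) :=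
    fun ω hω t => cauchySeq_tendsto_of_complete
      (cauchySeq_of_le_geometric ρ _ hρ1 fun n => hstep ω hω n t)
  -- On the exceptional null set the whole path is zero, so that every path is continuous.
  let Y : α → Ω → E := fun t ω => if h : ω ∈ good then (hlim ω h t).choose else 0
  have hY : ∀ ω ∈ good, ∀ t, Filter.Tendsto (fun n => Z n t ω) Filter.atTop (nhds (Y t ω)) := by
    intro ω hω t
    simp only [Y, dif_pos hω]
    exact (hlim ω hω t).choose_spec
  refine ⟨Y, fun t => ?_, fun t => ?_, fun ω => ?_⟩
  · refine stronglyMeasurable_of_tendsto Filter.atTop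
      (f := fun n => good.indicator (Z n t)) (fun n => (hZm n t).indicator hgood) ?_
    refine tendsto_pi_nhds.2 fun ω => ?_
    by_cases hω : ω ∈ good
    · simpa only [indicator_of_mem hω] using hY ω hω t
    · simp only [indicator_of_notMem hω, Y, dif_neg hω]
      exact tendsto_const_nhds
  -- For fixed t the means of V_n are summable, so almost surely V_n → 0. This forces Z_n(t) → X(t),
  -- which identifies the limit Y(t).
  · let V : ℕ → Ω → ℝ≥0∞ := fun n ω => ∑ a ∈ A n with dist t a < r n, ‖X a ω - X t ω‖ₑ ^ q
    have hVm : ∀ n, Measurable (V n) := fun n => Finset.measurable_fun_sum _ fun a _ => hdm a t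
    have hVint : ∀ n, ∫⁻ ω, V n ω ∂P ≤ 2 * M' * 2⁻¹ ^ n := by
      intro n
      have hcard' : ((A n).card : ℝ≥0∞) ≤ 2 ^ (n + 1) := by exact_mod_cast hcard n
      rw [lintegral_finsetSum _ fun a _ => hdm a t]
      calc _ ≤ ∑ a ∈ A n with dist t a < r n, M * (ENNReal.ofReal (2 * c) * 2⁻¹ ^ n) ^ 4 := by
            gcongr with a ha
            refine hedist n a t ?_
            have := (Finset.mem_filter.1 ha).2
            rw [dist_comm]
            linarith [hrpos n t]
        _ ≤ ∑ a ∈ A n, M * (ENNReal.ofReal (2 * c) * 2⁻¹ ^ n) ^ 4 := by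
            gcongr
            exact Finset.filter_subset _ _
        _ = (A n).card * (M * (ENNReal.ofReal (2 * c) * 2⁻¹ ^ n) ^ 4) := by
            simp only [Finset.sum_const, nsmul_eq_mul]
        _ ≤ 2 ^ (n + 1) * (M * (ENNReal.ofReal (2 * c) * 2⁻¹ ^ n) ^ 4) := by gcongr
        _ = 2 * M' * 2⁻¹ ^ n * (2 * 2⁻¹) ^ n * 2⁻¹ ^ n * 2⁻¹ ^ n := by
            rw [hM']
            simp only [mul_pow, pow_succ, pow_zero, one_mul]
            ring
        _ ≤ 2 * M' * 2⁻¹ ^ n * 1 * 1 * 1 := by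
            rw [h22, one_pow]
            have : (2⁻¹ : ℝ≥0∞) ^ n ≤ 1 := pow_le_one₀ zero_le (by simp)
            gcongr
        _ = _ := by simp
    have hVsum : ∫⁻ ω, ∑' n, V n ω ∂P ≠ ∞ := by
      rw [lintegral_tsum fun n => (hVm n).aemeasurable]
      refine ne_top_of_le_ne_top ?_ (ENNReal.tsum_le_tsum hVint)
      rw [ENNReal.tsum_mul_left]
      exact ENNReal.mul_ne_top (ENNReal.mul_ne_top (by simp) hM'_top) hgeom
    filter_upwards [hgood_ae, ae_lt_top (Measurable.tsum hVm) hVsum] with ω hω hV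
    refine tendsto_nhds_unique (hY ω hω t) ?_
    have hV0 : Filter.Tendsto (fun n => V n ω) Filter.atTop (nhds 0) :=
      ENNReal.tendsto_atTop_zero_of_tsum_ne_top hV.ne
    have hVtop : ∀ n, V n ω ≠ ∞ := fun n => ne_top_of_le_ne_top hV.ne (ENNReal.le_tsum n)
    have hV1 : Filter.Tendsto (fun n => (V n ω).toReal ^ (1 / q : ℝ)) Filter.atTop (nhds 0) := by
      have h1 := ((ENNReal.tendsto_toReal ENNReal.zero_ne_top).comp hV0).rpow_const
        (p := (1 / q : ℝ)) (Or.inr (by positivity))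
      have h2 : (1 / q : ℝ) ≠ 0 := by positivity
      rwa [ENNReal.toReal_zero, Real.zero_rpow h2] at h1
    refine tendsto_iff_norm_sub_tendsto_zero.2 (squeeze_zero (fun _ => norm_nonneg _) (fun n => ?_) hV1)
    refine norm_netInterp_sub_le (hnet n) _ t _ fun a ha hta => ?_
    exact norm_le_rpow_of_enorm_pow_le hq (hVtop n) (Finset.single_le_sum
      (f := fun a => ‖X a ω - X t ω‖ₑ ^ q) (fun _ _ => zero_le) (Finset.mem_filter.2 ⟨ha, hta⟩))
  · by_cases hω : ω ∈ good
    · have hunif : TendstoUniformly (fun n t => Z n t ω) (fun t => Y t ω) Filter.atTop := by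
        have h0 : Filter.Tendsto (fun n : ℕ => (K ω).toReal ^ (1 / q : ℝ) * ρ ^ n / (1 - ρ))
            Filter.atTop (nhds 0) := by
          have := ((tendsto_pow_atTop_nhds_zero_of_lt_one (by positivity) hρ1).const_mul
            ((K ω).toReal ^ (1 / q : ℝ))).div_const (1 - ρ)
          simpa using this
        rw [Metric.tendstoUniformly_iff]
        intro ε hε
        filter_upwards [h0.eventually_lt_const hε] with n hn t
        rw [dist_comm]
        exact (dist_le_of_le_geometric_of_tendsto ρ _ hρ1 (fun n => hstep ω hω n t)
          (hY ω hω t) n).trans_lt hn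
      exact hunif.continuous (Filter.Frequently.of_forall fun n => continuous_netInterp (hnet n) _)
    · simp only [Y, dif_neg hω]
      exact continuous_const

end Continuity

/-! ### Dyadic grids in the time interval -/

section Net

theorem exists_net_Icc {T : ℝ} (hT : 0 < T) (n : ℕ) :
    ∃ A : Finset (Icc (0 : ℝ) T), A.card ≤ 2 ^ (n + 1) ∧
      ∀ t, ∃ a ∈ A, dist t a < 2 * T * (1 / 2) ^ n := by
  classical
  refine ⟨(Finset.range (2 ^ n + 1)).image fun j : ℕ => projIcc 0 T hT.le (j * (T / 2 ^ n)), ?_, ?_⟩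
  · refine Finset.card_image_le.trans ?_
    rw [Finset.card_range, pow_succ]
    have : 1 ≤ 2 ^ n := Nat.one_le_two_pow
    omega
  · intro t
    have hδ : 0 < T / 2 ^ n := by positivity
    set j := ⌊(t : ℝ) / (T / 2 ^ n)⌋₊ with hj
    have h1 : (j : ℝ) * (T / 2 ^ n) ≤ t := (le_div_iff₀ hδ).1 (Nat.floor_le (div_nonneg t.2.1 hδ.le))
    have h2 : (t : ℝ) < (j + 1) * (T / 2 ^ n) := (div_lt_iff₀ hδ).1 (Nat.lt_floor_add_one _)
    have hmem : (j : ℝ) * (T / 2 ^ n) ∈ Icc 0 T := ⟨by positivity, h1.trans t.2.2⟩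
    have hjle : j ≤ 2 ^ n := by
      have h3 : (j : ℝ) * (T / 2 ^ n) ≤ 2 ^ n * (T / 2 ^ n) := by
        rw [mul_div_cancel₀ _ (by positivity)]
        exact hmem.2
      exact_mod_cast le_of_mul_le_mul_right h3 hδ
    refine ⟨_, Finset.mem_image_of_mem _ (Finset.mem_range.2 (Nat.lt_succ_of_le hjle)), ?_⟩
    rw [projIcc_of_mem _ hmem, Subtype.dist_eq, Real.dist_eq, abs_of_nonneg (sub_nonneg.2 h1)]
    have h4 : 2 * T * (1 / 2) ^ n = 2 * (T / 2 ^ n) := by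
      rw [one_div, inv_pow]
      ring
    rw [h4]
    linarith

end Net

/-! ### Moments of Gaussian vectors -/

section Moments

variable {Ω : Type*} [MeasurableSpace Ω] {P : Measure Ω}

/-- Orthonormal vectors are √2 apart, so balls of radius 1/2 around them are disjoint. Countability
lets almost sure statements hold for all basis vectors simultaneously. -/
theorem countable_of_orthonormal {ι H : Type*} [NormedAddCommGroup H] [InnerProductSpace ℝ H]
    [TopologicalSpace.SeparableSpace H] {b : ι → H} (hb : Orthonormal ℝ b) : Countable ι := by
  have hdist : ∀ i j, i ≠ j → 1 < dist (b i) (b j) := by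
    intro i j hij
    have h : ‖b i - b j‖ ^ 2 = 2 := by
      rw [norm_sub_sq_real, hb.1 i, hb.1 j, hb.2 hij]
      norm_num
    rw [dist_eq_norm]
    nlinarith [norm_nonneg (b i - b j)]
  have hd : Pairwise (Function.onFun Disjoint fun i => Metric.ball (b i) (1 / 2)) := by
    intro i j hij
    exact Metric.ball_disjoint_ball (by linarith [hdist i j hij])
  exact hd.countable_of_isOpen_disjoint (fun i => Metric.isOpen_ball)
    fun i => Metric.nonempty_ball.2 (by norm_num)

theorem eLpNorm_sq_gaussianReal_ne_top {k : ℝ≥0∞} (hk : k ≠ ∞) :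
    eLpNorm (fun x : ℝ => x ^ 2) k (gaussianReal 0 1) ≠ ∞ := by
  have h1 : MemLp (fun x : ℝ => x) (k * 2) (gaussianReal 0 1) :=
    memLp_id_gaussianReal' _ (ENNReal.mul_ne_top hk (by simp))
  have h2 := h1.norm_rpow_div 2
  rw [ENNReal.mul_div_cancel_right (by simp) (by simp)] at h2
  refine (eLpNorm_congr_norm_ae (ae_of_all _ fun x => ?_)).trans_lt h2.2 |>.ne
  simp

theorem gaussianReal_sq_eq_map (v : ℝ≥0) :
    gaussianReal 0 (v ^ 2) = (gaussianReal 0 1).map (fun x => (v : ℝ) * x) := by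
  rw [gaussianReal_map_const_mul, mul_zero, mul_one]
  congr 1

theorem eLpNorm_sq_eq_of_map_eq {X : Ω → ℝ} {v : ℝ≥0} {k : ℝ≥0∞} (hX : AEMeasurable X P)
    (hmap : P.map X = gaussianReal 0 (v ^ 2)) :
    eLpNorm (fun ω => X ω ^ 2) k P =
      (v : ℝ≥0∞) ^ 2 * eLpNorm (fun x : ℝ => x ^ 2) k (gaussianReal 0 1) := by
  have h3 : eLpNorm (fun x : ℝ => x ^ 2) k (P.map X) = eLpNorm (fun ω => X ω ^ 2) k P :=
    eLpNorm_map_measure (by fun_prop) hX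
  have h4 : eLpNorm (fun x : ℝ => x ^ 2) k ((gaussianReal 0 1).map (fun x => (v : ℝ) * x)) =
      eLpNorm (((v : ℝ) ^ 2) • fun x : ℝ => x ^ 2) k (gaussianReal 0 1) := by
    rw [eLpNorm_map_measure (by fun_prop) (by fun_prop)]
    congr 1 with x
    simp [mul_pow]
  rw [← h3, hmap, gaussianReal_sq_eq_map, h4, eLpNorm_const_smul, enorm_pow,
    Real.enorm_of_nonneg v.coe_nonneg, ENNReal.ofReal_coe_nnreal]

theorem exists_eLpNorm_sq_le (k : ℝ≥0∞) (hk : k ≠ ∞) :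
    ∃ c : ℝ≥0, ∀ (X : Ω → ℝ) (v : ℝ≥0), AEMeasurable X P → P.map X = gaussianReal 0 (v ^ 2) →
      eLpNorm (fun ω => X ω ^ 2) k P ≤ c * (v : ℝ≥0∞) ^ 2 := by
  refine ⟨(eLpNorm (fun x : ℝ => x ^ 2) k (gaussianReal 0 1)).toNNReal, fun X v hX hmap => ?_⟩
  rw [eLpNorm_sq_eq_of_map_eq hX hmap, ENNReal.coe_toNNReal (eLpNorm_sq_gaussianReal_ne_top hk),
    mul_comm]

variable {H : Type*} [NormedAddCommGroup H] [InnerProductSpace ℝ H] [CompleteSpace H]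
  [TopologicalSpace.SeparableSpace H]

/-- All moments of a centred Gaussian vector are controlled by the second moment. -/
theorem exists_eLpNorm_norm_sq_le (k : ℝ≥0∞) (hk1 : 1 ≤ k) (hk : k ≠ ∞) :
    ∃ c : ℝ≥0, ∀ X : Lp H 2 P,
      (∀ L : H →L[ℝ] ℝ, P.map (L.compLpL 2 P X) = gaussianReal 0 (‖L.compLpL 2 P X‖₊ ^ 2)) →
      eLpNorm (fun ω => ‖X ω‖ ^ 2) k P ≤ c * ‖X‖ₑ ^ 2 := by
  obtain ⟨c, hc⟩ := exists_eLpNorm_sq_le (P := P) k hk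
  refine ⟨c, fun X hX => ?_⟩
  obtain ⟨w, b, -⟩ := exists_hilbertBasis ℝ H
  have := countable_of_orthonormal b.orthonormal
  let Y : w → Lp ℝ 2 P := fun i => (innerSL ℝ (b i)).compLpL 2 P X
  have hYae : ∀ᵐ ω ∂P, ∀ i, Y i ω = ⟪b i, X ω⟫ :=
    ae_all_iff.2 fun i => (innerSL ℝ (b i)).coeFn_compLpL X
  have hsum : ∀ ω, HasSum (fun i => ⟪b i, X ω⟫ ^ 2) (‖X ω‖ ^ 2) := by
    intro ω
    have h := b.hasSum_inner_mul_inner (X ω) (X ω)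
    rw [real_inner_self_eq_norm_sq] at h
    refine h.congr_fun fun i => ?_
    rw [real_inner_comm, sq]
  obtain ⟨s, hs⟩ := Filter.exists_seq_tendsto (Filter.atTop : Filter (Finset w))
  have hnorm : ∀ s : Finset w, ∑ i ∈ s, ‖Y i‖ ^ 2 ≤ ‖X‖ ^ 2 := by
    intro s
    simp_rw [← real_inner_self_eq_norm_sq, L2.inner_def]
    rw [← integral_finsetSum _ fun i _ => L2.integrable_inner _ _]
    refine integral_mono_ae (integrable_finsetSum _ fun i _ => L2.integrable_inner _ _)
      (L2.integrable_inner _ _) ?_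
    filter_upwards [hYae] with ω hω
    simp only [hω, real_inner_self_eq_norm_sq, Real.norm_eq_abs, sq_abs]
    exact sum_le_hasSum s (fun i _ => sq_nonneg _) (hsum ω)
  -- Minkowski in L^k is applied to the squared coordinates: each costs c times its variance, and
  -- the variances add up to at most ‖X‖². The bound is free of dimension, so Fatou passes to the
  -- full sum.
  have hfin : ∀ s : Finset w, eLpNorm (fun ω => ∑ i ∈ s, Y i ω ^ 2) k P ≤ c * ‖X‖ₑ ^ 2 := by
    intro s
    have h1 : (fun ω => ∑ i ∈ s, Y i ω ^ 2) = ∑ i ∈ s, fun ω => Y i ω ^ 2 := by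
      ext ω
      rw [Finset.sum_apply]
    rw [h1]
    refine (eLpNorm_sum_le (fun i _ => (Lp.aestronglyMeasurable (Y i)).pow 2) hk1).trans ?_
    refine (Finset.sum_le_sum fun i _ =>
      hc (Y i) ‖Y i‖₊ (Lp.aestronglyMeasurable (Y i)).aemeasurable (hX _)).trans ?_
    rw [← Finset.mul_sum]
    gcongr
    have h2 : ∑ i ∈ s, ‖Y i‖₊ ^ 2 ≤ ‖X‖₊ ^ 2 := by
      rw [← NNReal.coe_le_coe]
      push_cast
      exact hnorm s
    rw [enorm_eq_nnnorm]
    exact_mod_cast h2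
  have hlim := Lp.eLpNorm_lim_le_liminf_eLpNorm (p := k) (μ := P)
    (f := fun n ω => ∑ i ∈ s n, Y i ω ^ 2)
    (fun n => Finset.aestronglyMeasurable_fun_sum _ fun i _ => (Lp.aestronglyMeasurable (Y i)).pow 2)
    (fun ω => ‖X ω‖ ^ 2) (by
      filter_upwards [hYae] with ω hω
      simp only [hω]
      exact (hsum ω).comp hs)
  refine hlim.trans (Filter.liminf_le_of_frequently_le' (Filter.Frequently.of_forall fun n => hfin _))

theorem exists_lintegral_enorm_pow_le (k : ℕ) (hk : k ≠ 0) :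
    ∃ c : ℝ≥0, ∀ X : Lp H 2 P,
      (∀ L : H →L[ℝ] ℝ, P.map (L.compLpL 2 P X) = gaussianReal 0 (‖L.compLpL 2 P X‖₊ ^ 2)) →
      ∫⁻ ω, ‖X ω‖ₑ ^ (2 * k) ∂P ≤ c * ‖X‖ₑ ^ (2 * k) := by
  obtain ⟨c, hc⟩ := exists_eLpNorm_norm_sq_le (P := P) (H := H) k
    (by exact_mod_cast Nat.one_le_iff_ne_zero.2 hk) (by simp)
  refine ⟨c ^ k, fun X hX => ?_⟩
  have h := hc X hX
  rw [eLpNorm_eq_lintegral_rpow_enorm_toReal (by exact_mod_cast hk) (by simp)] at h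
  simp only [ENNReal.toReal_natCast, one_div, ENNReal.rpow_natCast, enorm_pow, enorm_norm] at h
  rw [ENNReal.rpow_inv_le_iff (by positivity), ENNReal.rpow_natCast] at h
  simp only [pow_mul]
  refine h.trans_eq ?_
  push_cast
  rw [mul_pow]

end Moments

/-! ### The trace of a nuclear operator -/

section TraceFormula

variable {H : Type*} [NormedAddCommGroup H] [InnerProductSpace ℝ H]

theorem HilbertBasis.sum_abs_inner_mul_inner_le {ι : Type*} (b : HilbertBasis ι ℝ H) (x y : H)
    (s : Finset ι) : ∑ i ∈ s, |⟪x, b i⟫ * ⟪b i, y⟫| ≤ ‖x‖ * ‖y‖ := by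
  have hb : ∀ x : H, √(∑ i ∈ s, ‖⟪b i, x⟫‖ ^ 2) ≤ ‖x‖ := fun x =>
    Real.sqrt_le_iff.2 ⟨norm_nonneg _, b.orthonormal.sum_inner_products_le x⟩
  calc ∑ i ∈ s, |⟪x, b i⟫ * ⟪b i, y⟫| = ∑ i ∈ s, ‖⟪b i, x⟫‖ * ‖⟪b i, y⟫‖ := by
        simp only [abs_mul, Real.norm_eq_abs, real_inner_comm]
    _ ≤ √(∑ i ∈ s, ‖⟪b i, x⟫‖ ^ 2) * √(∑ i ∈ s, ‖⟪b i, y⟫‖ ^ 2) :=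
        Real.sum_mul_le_sqrt_mul_sqrt _ _ _
    _ ≤ ‖x‖ * ‖y‖ := mul_le_mul (hb x) (hb y) (Real.sqrt_nonneg _) (norm_nonneg _)

/-- The double series in n and i converges absolutely by Cauchy–Schwarz and Bessel; after exchanging
the sums, Parseval evaluates the one over i. The result does not involve the basis. -/
theorem trace_eq_tsum_inner {ι : Type*} (b : HilbertBasis ι ℝ H) (A : H →L[ℝ] H) (u v : ℕ → H)
    (huv : Summable fun n => ‖u n‖ * ‖v n‖) (hA : ∀ z, HasSum (fun n => ⟪u n, z⟫ • v n) (A z)) :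
    trace b A = ∑' n, ⟪u n, v n⟫ := by
  have hi : ∀ i, ⟪A (b i), b i⟫ = ∑' n, ⟪u n, b i⟫ * ⟪b i, v n⟫ := by
    intro i
    have h := (hA (b i)).mapL (innerSL ℝ (b i))
    rw [real_inner_comm]
    refine (h.tsum_eq.symm.trans (tsum_congr fun n => ?_))
    simp
  have hsum : Summable (Function.uncurry fun (n : ℕ) (i : ι) => ⟪u n, b i⟫ * ⟪b i, v n⟫) := by
    refine Summable.of_norm ?_
    have hs : ∀ n, Summable fun i => ‖⟪u n, b i⟫ * ⟪b i, v n⟫‖ := fun n =>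
      summable_of_sum_le (fun i => norm_nonneg _)
        fun s => HilbertBasis.sum_abs_inner_mul_inner_le b (u n) (v n) s
    refine (summable_prod_of_nonneg fun _ => norm_nonneg _).2 ⟨hs, ?_⟩
    refine Summable.of_nonneg_of_le (fun n => tsum_nonneg fun i => norm_nonneg _) (fun n => ?_) huv
    exact Real.tsum_le_of_sum_le (fun i => norm_nonneg _)
      fun s => HilbertBasis.sum_abs_inner_mul_inner_le b (u n) (v n) s
  rw [trace, tsum_congr hi, hsum.tsum_comm]
  exact tsum_congr fun n => (b.hasSum_inner_mul_inner (u n) (v n)).tsum_eq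

end TraceFormula

/-! ### Expansions of B Q A* -/

section CovarianceOperator

variable {U : Type*} [NormedAddCommGroup U] [InnerProductSpace ℝ U] [CompleteSpace U]
  {H : Type*} [NormedAddCommGroup H] [InnerProductSpace ℝ H] [CompleteSpace H]
  (e : HilbertBasis ℕ ℝ U) {lam : ℕ → ℝ}

theorem hasSum_comp_covOp_comp_adjoint (hlam : Summable fun n => |lam n|) (A B : U →L[ℝ] H) (x : H) :
    HasSum (fun n => ⟪A (e n), x⟫ • (lam n • B (e n))) ((B ∘L covOp e lam ∘L A†) x) := by
  have h := (hasSum_covOp e lam hlam ((A†) x)).mapL B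
  refine h.congr_fun fun n => ?_
  rw [map_smul, smul_smul, ContinuousLinearMap.adjoint_inner_left, real_inner_comm, mul_comm]

omit [CompleteSpace U] [CompleteSpace H] in
theorem summable_norm_mul_norm (hlam : Summable fun n => |lam n|) (A B : U →L[ℝ] H) :
    Summable fun n => ‖A (e n)‖ * ‖lam n • B (e n)‖ := by
  refine Summable.of_nonneg_of_le (fun n => by positivity) (fun n => ?_)
    (hlam.mul_left (‖A‖ * ‖B‖))
  have hA := A.le_opNorm (e n)
  have hB := B.le_opNorm (e n)
  rw [e.orthonormal.1 n, mul_one] at hA hB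
  rw [norm_smul, Real.norm_eq_abs]
  calc ‖A (e n)‖ * (|lam n| * ‖B (e n)‖) ≤ ‖A‖ * (|lam n| * ‖B‖) := by gcongr
    _ = _ := by ring

theorem isTraceClass_comp_covOp_comp_adjoint (hlam : Summable fun n => |lam n|) (A B : U →L[ℝ] H) :
    IsTraceClass (B ∘L covOp e lam ∘L A†) :=
  ⟨_, _, summable_norm_mul_norm e hlam A B, hasSum_comp_covOp_comp_adjoint e hlam A B⟩

theorem trace_comp_covOp_comp_adjoint (hlam : Summable fun n => |lam n|) (A B : U →L[ℝ] H)
    {ι : Type*} (b : HilbertBasis ι ℝ H) :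
    trace b (B ∘L covOp e lam ∘L A†) = ∑' n, lam n * ⟪A (e n), B (e n)⟫ := by
  rw [trace_eq_tsum_inner b _ _ _ (summable_norm_mul_norm e hlam A B)
    (hasSum_comp_covOp_comp_adjoint e hlam A B)]
  simp only [real_inner_smul_right]

/-- The product of two real numbers is kept as an inner product in ℝ, so that `hasSum_kernelForm`
applies with K = ℝ just as it does with K = H for the trace. -/
theorem inner_comp_covOp_comp_adjoint (hlam : Summable fun n => |lam n|) (A B : U →L[ℝ] H)
    (x y : H) :
    ⟪(B ∘L covOp e lam ∘L A†) x, y⟫ = ∑' n, lam n * ⟪⟪x, A (e n)⟫, ⟪y, B (e n)⟫⟫ := by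
  have h := (hasSum_comp_covOp_comp_adjoint e hlam A B x).mapL (innerSL ℝ y)
  rw [real_inner_comm]
  refine h.tsum_eq.symm.trans (tsum_congr fun n => ?_)
  rw [innerSL_apply_apply, real_inner_smul_right, real_inner_smul_right, real_inner_eq_re_inner,
    RCLike.inner_apply, real_inner_comm x]
  simp
  ring

end CovarianceOperator

/-! ### Exchanging the series with the kernel integral -/

section DominatedSeries

theorem integrable_tsum_and_hasSum_integral {α : Type*} [MeasurableSpace α] {μ : Measure α}
    {F : ℕ → α → ℝ} {D : α → ℝ} {c : ℕ → ℝ} (hF : ∀ n, Integrable (F n) μ) (hD : Integrable D μ)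
    (hc : Summable c) (hle : ∀ n z, |F n z| ≤ c n * D z) :
    Integrable (fun z => ∑' n, F n z) μ ∧
      HasSum (fun n => ∫ z, F n z ∂μ) (∫ z, ∑' n, F n z ∂μ) := by
  have hs : ∀ z, Summable fun n => F n z := fun z =>
    Summable.of_norm_bounded (hc.mul_right (D z)) fun n => hle n z
  refine ⟨Integrable.mono' (hD.const_mul (∑' n, c n)) ?_ (ae_of_all _ fun z => ?_), ?_⟩
  · refine aestronglyMeasurable_of_tendsto_ae (f := fun N z => ∑ n ∈ Finset.range N, F n z)
      Filter.atTop (fun N => Finset.aestronglyMeasurable_fun_sum _ fun n _ => (hF n).1)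
      (ae_of_all _ fun z => (hs z).hasSum.tendsto_sum_nat)
  · rw [← tsum_mul_right]
    exact tsum_of_norm_bounded (hc.mul_right (D z)).hasSum fun n => hle n z
  · refine hasSum_integral_of_summable_integral_norm hF ?_
    refine Summable.of_nonneg_of_le (fun n => integral_nonneg fun z => norm_nonneg _) (fun n => ?_)
      (hc.mul_right (∫ z, D z ∂μ))
    rw [← integral_const_mul]
    exact integral_mono (hF n).norm (hD.const_mul _) (hle n)

variable {T : ℝ} {φ : ℝ → ℝ → ℝ} {p : ℝ≥0∞}

theorem integral_timeMeasure_prod (hT : 0 ≤ T) {F : ℝ × ℝ → ℝ}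
    (hF : Integrable F ((timeMeasure T).prod (timeMeasure T))) :
    ∫ z, F z ∂((timeMeasure T).prod (timeMeasure T)) =
      ∫ v in (0 : ℝ)..T, ∫ u in (0 : ℝ)..T, F (u, v) := by
  rw [integral_prod_symm _ hF]
  simp only [intervalIntegral.integral_of_le hT, ← integral_Icc_eq_integral_Ioc]

theorem KernelCondition.hasSum_kernelForm {K E F : Type*} [NormedAddCommGroup K]
    [InnerProductSpace ℝ K] [NormedAddCommGroup E] [NormedAddCommGroup F]
    (hφ : KernelCondition T φ p) (hp : 1 ≤ p) {lam : ℕ → ℝ} (hlam : Summable fun n => |lam n|)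
    {a b : ℕ → ℝ → K} (ha : ∀ n, MemLp (a n) p (timeMeasure T))
    (hb : ∀ n, MemLp (b n) p (timeMeasure T)) {f : ℝ → E} {k : ℝ → F}
    (hf : MemLp f p (timeMeasure T)) (hk : MemLp k p (timeMeasure T)) (C : ℝ)
    (hle : ∀ n u v, ‖a n u‖ * ‖b n v‖ ≤ C * (‖f u‖ * ‖k v‖)) :
    Integrable (fun z : ℝ × ℝ => (∑' n, lam n * ⟪a n z.1, b n z.2⟫) * φ z.1 z.2)
        ((timeMeasure T).prod (timeMeasure T)) ∧
      HasSum (fun n => lam n * kernelForm T φ (a n) (b n))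
        (∫ z : ℝ × ℝ, (∑' n, lam n * ⟪a n z.1, b n z.2⟫) * φ z.1 z.2
          ∂((timeMeasure T).prod (timeMeasure T))) := by
  have h := integrable_tsum_and_hasSum_integral
    (F := fun n (z : ℝ × ℝ) => lam n * (⟪a n z.1, b n z.2⟫ * φ z.1 z.2))
    (fun n => (hφ.integrable_inner hp (ha n) (hb n)).const_mul (lam n))
    (hφ.integrable_norm_mul_norm hp hf hk) (hlam.mul_right C) fun n z => by
      rw [abs_mul, abs_mul]
      calc |lam n| * (|⟪a n z.1, b n z.2⟫| * |φ z.1 z.2|)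
          ≤ |lam n| * ((C * (‖f z.1‖ * ‖k z.2‖)) * |φ z.1 z.2|) := by
            gcongr
            exact (abs_real_inner_le_norm _ _).trans (hle n _ _)
        _ = _ := by ring
  have h1 : ∀ z : ℝ × ℝ, ∑' n, lam n * (⟪a n z.1, b n z.2⟫ * φ z.1 z.2) =
      (∑' n, lam n * ⟪a n z.1, b n z.2⟫) * φ z.1 z.2 := fun z => by
    rw [← tsum_mul_right]
    exact tsum_congr fun n => (mul_assoc _ _ _).symm
  simp only [h1, integral_const_mul] at h
  exact h

end DominatedSeries

/-! ### Hölder estimates for truncated integrands -/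

section IndicatorIncrements

variable {T : ℝ} {p q : ℝ≥0∞} {E : Type*} [NormedAddCommGroup E] {h : ℝ → E}

theorem eLpNorm_indicator_Ioc_le (hpq : p ≤ q) (hh : AEStronglyMeasurable h (timeMeasure T))
    (hδ : 0 ≤ 1 / p.toReal - 1 / q.toReal) (s t : ℝ) :
    eLpNorm ((Ioc s t).indicator h) p (timeMeasure T) ≤
      eLpNorm h q (timeMeasure T) * ENNReal.ofReal (t - s) ^ (1 / p.toReal - 1 / q.toReal) := by
  rw [eLpNorm_indicator_eq_eLpNorm_restrict measurableSet_Ioc]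
  refine (eLpNorm_le_eLpNorm_mul_rpow_measure_univ hpq hh.restrict).trans ?_
  have h1 : (timeMeasure T).restrict (Ioc s t) univ ≤ ENNReal.ofReal (t - s) := by
    rw [Measure.restrict_apply_univ, ← Real.volume_Ioc]
    exact Measure.restrict_apply_le _ _
  have h2 := ENNReal.rpow_le_rpow h1 hδ
  gcongr
  exact Measure.restrict_le_self

theorem indicator_Ioc_sub_indicator_Ioc {s t : ℝ} (hs : 0 ≤ s) (hst : s ≤ t) :
    (Ioc 0 t).indicator h - (Ioc 0 s).indicator h = (Ioc s t).indicator h := by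
  rw [sub_eq_iff_eq_add', ← Ioc_union_Ioc_eq_Ioc hs hst, indicator_union_of_disjoint]
  · rfl
  · exact disjoint_left.2 fun u hu hu' => absurd hu.2 (not_le.2 hu'.1)

/-- `1_{(0, t]} h` as an element of `L^p`. -/
def truncLp (hh : MemLp h p (timeMeasure T)) (t : ℝ) : Lp E p (timeMeasure T) :=
  MemLp.toLp ((Ioc 0 t).indicator h) (hh.indicator measurableSet_Ioc)

theorem coeFn_truncLp (hh : MemLp h p (timeMeasure T)) (t : ℝ) :
    truncLp hh t =ᵐ[timeMeasure T] (Ioc 0 t).indicator h :=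
  MemLp.coeFn_toLp _

theorem enorm_truncLp_sub_le [Fact (1 ≤ p)] (hpq : p ≤ q) (hh : MemLp h p (timeMeasure T))
    (hδ : 0 ≤ 1 / p.toReal - 1 / q.toReal) (s t : Icc (0 : ℝ) T) :
    ‖truncLp hh s - truncLp hh t‖ₑ ≤
      eLpNorm h q (timeMeasure T) * edist s t ^ (1 / p.toReal - 1 / q.toReal) := by
  wlog hst : t ≤ s generalizing s t
  · rw [← enorm_neg, neg_sub, edist_comm]
    exact this t s (le_of_not_ge hst)
  rw [truncLp, truncLp, ← MemLp.toLp_sub, Lp.enorm_toLp, indicator_Ioc_sub_indicator_Ioc t.2.1 hst, edist_dist,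
    Subtype.dist_eq, Real.dist_eq, abs_of_nonneg (sub_nonneg.2 (show (t : ℝ) ≤ s from hst))]
  exact eLpNorm_indicator_Ioc_le hpq hh.1 hδ _ _

end IndicatorIncrements

/-! ### Inner products of orthogonal series -/

section SeriesInnerProducts

variable {Ω : Type*} [MeasurableSpace Ω] {P : Measure Ω} {T : ℝ} {φ : ℝ → ℝ → ℝ} {p : ℝ≥0∞}
  [Fact (1 ≤ p)] {K : Type*} [NormedAddCommGroup K] [InnerProductSpace ℝ K]

/-- Pairing Y with the range of `J n` sees only its n-th term. The diagonal terms then carry √λ_n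
twice. -/
theorem hasSum_inner_of_orthogonal {J : ℕ → Lp K p (timeMeasure T) →L[ℝ] Lp K 2 P}
    (hJ : ∀ n f k, ⟪J n f, J n k⟫ = kernelForm T φ f k)
    (horth : ∀ n m, n ≠ m → ∀ f k, ⟪J n f, J m k⟫ = 0) {lam : ℕ → ℝ} (hlam : ∀ n, 0 ≤ lam n)
    {a b : ℕ → Lp K p (timeMeasure T)} {X Y : Lp K 2 P}
    (hX : HasSum (fun n => √(lam n) • J n (a n)) X) (hY : HasSum (fun n => √(lam n) • J n (b n)) Y) :
    HasSum (fun n => lam n * kernelForm T φ (a n) (b n)) ⟪X, Y⟫ := by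
  have h1 : ∀ n, ⟪J n (a n), Y⟫ = √(lam n) * kernelForm T φ (a n) (b n) := by
    intro n
    have h := hY.mapL (innerSL ℝ (J n (a n)))
    refine h.unique ?_
    have h2 := hasSum_single (f := fun m => innerSL ℝ (J n (a n)) (√(lam m) • J m (b m))) n
      fun m hm => by rw [innerSL_apply_apply, real_inner_smul_right, horth n m hm.symm, mul_zero]
    rwa [innerSL_apply_apply, real_inner_smul_right, hJ] at h2
  have h := hX.mapL (innerSL ℝ Y)
  rw [innerSL_apply_apply, real_inner_comm] at h
  refine h.congr_fun fun n => ?_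
  rw [innerSL_apply_apply, real_inner_smul_right, real_inner_comm, h1, ← mul_assoc,
    Real.mul_self_sqrt (hlam n)]

end SeriesInnerProducts

/-! ### The series for ∫h dG as a bounded linear map -/

section OperatorSeries

variable {Ω : Type*} [MeasurableSpace Ω] {P : Measure Ω} {T : ℝ} {p : ℝ≥0∞}
  [Fact (1 ≤ p)] {U : Type*} [NormedAddCommGroup U] [InnerProductSpace ℝ U]
  {H : Type*} [NormedAddCommGroup H] [InnerProductSpace ℝ H]
  (e : HilbertBasis ℕ ℝ U) (lam : ℕ → ℝ)
  (I : ℕ → Lp H p (timeMeasure T) →L[ℝ] Lp H 2 P)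

/-- The function `s ↦ h(s) u` in `L^p([0, T]; H)`, for `h ∈ L^p([0, T]; L(U, H))`. -/
def evalLp (u : U) (h : Lp (U →L[ℝ] H) p (timeMeasure T)) : Lp H p (timeMeasure T) :=
  (ContinuousLinearMap.apply ℝ H u).compLpL p (timeMeasure T) h

theorem coeFn_evalLp (u : U) (h : Lp (U →L[ℝ] H) p (timeMeasure T)) :
    evalLp u h =ᵐ[timeMeasure T] fun s => h s u :=
  ContinuousLinearMap.coeFn_compLpL _ h

theorem evalLp_sub (u : U) (h k : Lp (U →L[ℝ] H) p (timeMeasure T)) :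
    evalLp u (h - k) = evalLp u h - evalLp u k := map_sub _ _ _

theorem norm_evalLp_le (u : U) (h : Lp (U →L[ℝ] H) p (timeMeasure T)) :
    ‖evalLp u h‖ ≤ ‖u‖ * ‖h‖ := by
  refine Lp.norm_le_mul_norm_of_ae_le_mul ?_
  filter_upwards [coeFn_evalLp u h] with s hs
  rw [hs, mul_comm]
  exact (h s).le_opNorm u

/-- The term `√λ_n ∫ h(s) e_n dg_n(s)` of the series, as a function of `h ∈ L^p([0, T]; L(U, H))`. -/
def operatorTerm (h : Lp (U →L[ℝ] H) p (timeMeasure T)) (n : ℕ) : Lp H 2 P :=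
  √(lam n) • I n (evalLp (e n) h)

/-- The sum `∑_n √λ_n ∫ h(s) e_n dg_n(s)`, as a function of `h ∈ L^p([0, T]; L(U, H))`. -/
def operatorSum (h : Lp (U →L[ℝ] H) p (timeMeasure T)) : Lp H 2 P :=
  ∑' n, operatorTerm e lam I h n

variable {I lam} {C : ℝ}

theorem norm_operatorTerm_le (hC : 0 ≤ C) (hI : ∀ n f, ‖I n f‖ ≤ C * ‖f‖)
    (h : Lp (U →L[ℝ] H) p (timeMeasure T)) (n : ℕ) :
    ‖operatorTerm e lam I h n‖ ≤ √(lam n) * (C * ‖h‖) := by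
  rw [operatorTerm, norm_smul, Real.norm_of_nonneg (Real.sqrt_nonneg _)]
  gcongr
  refine (hI n _).trans ?_
  gcongr
  refine (norm_evalLp_le _ _).trans_eq ?_
  rw [e.orthonormal.1 n, one_mul]

variable [CompleteSpace H]

theorem summable_operatorTerm (hlam : Summable fun n => √(lam n)) (hC : 0 ≤ C)
    (hI : ∀ n f, ‖I n f‖ ≤ C * ‖f‖) (h : Lp (U →L[ℝ] H) p (timeMeasure T)) :
    Summable (operatorTerm e lam I h) :=
  Summable.of_norm_bounded (hlam.mul_right _) (norm_operatorTerm_le e hC hI h)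

omit [CompleteSpace H] in
theorem norm_operatorSum_le (hlam : Summable fun n => √(lam n)) (hC : 0 ≤ C)
    (hI : ∀ n f, ‖I n f‖ ≤ C * ‖f‖) (h : Lp (U →L[ℝ] H) p (timeMeasure T)) :
    ‖operatorSum e lam I h‖ ≤ (∑' n, √(lam n)) * (C * ‖h‖) := by
  rw [← tsum_mul_right]
  exact tsum_of_norm_bounded (hlam.mul_right _).hasSum (norm_operatorTerm_le e hC hI h)

theorem operatorSum_sub (hlam : Summable fun n => √(lam n)) (hC : 0 ≤ C)
    (hI : ∀ n f, ‖I n f‖ ≤ C * ‖f‖) (h k : Lp (U →L[ℝ] H) p (timeMeasure T)) :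
    operatorSum e lam I (h - k) = operatorSum e lam I h - operatorSum e lam I k := by
  rw [operatorSum, operatorSum, operatorSum, ← (summable_operatorTerm e hlam hC hI h).tsum_sub
    (summable_operatorTerm e hlam hC hI k)]
  refine tsum_congr fun n => ?_
  rw [operatorTerm, evalLp_sub, map_sub, smul_sub]
  rfl

theorem compLpL_operatorSum_mem {G : Submodule ℝ (Lp ℝ 2 P)} (hG : IsClosed (G : Set (Lp ℝ 2 P)))
    (hmem : ∀ n (L : H →L[ℝ] ℝ) f, L.compLpL 2 P (I n f) ∈ G) (hlam : Summable fun n => √(lam n))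
    (hC : 0 ≤ C) (hI : ∀ n f, ‖I n f‖ ≤ C * ‖f‖) (L : H →L[ℝ] ℝ)
    (h : Lp (U →L[ℝ] H) p (timeMeasure T)) : L.compLpL 2 P (operatorSum e lam I h) ∈ G := by
  refine hG.mem_of_tendsto ((summable_operatorTerm e hlam hC hI h).hasSum.mapL (L.compLpL 2 P))
    (Filter.Eventually.of_forall fun s => G.sum_mem fun n _ => ?_)
  rw [operatorTerm, map_smul]
  exact G.smul_mem _ (hmem n L _)

variable [TopologicalSpace.SeparableSpace H]

/-- Continuity of `t ↦ ∑_n √λ_n ∫_0^t h(s) e_n dg_n(s)` for `h` in a better Lebesgue space. -/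
theorem exists_continuous_operatorSum {q : ℝ≥0∞} (hT : 0 < T)
    {G : Submodule ℝ (Lp ℝ 2 P)} (hG : IsClosed (G : Set (Lp ℝ 2 P)))
    (hgauss : ∀ X ∈ G, P.map X = gaussianReal 0 (‖X‖₊ ^ 2))
    (hmem : ∀ n (L : H →L[ℝ] ℝ) f, L.compLpL 2 P (I n f) ∈ G) (hlam : Summable fun n => √(lam n))
    (hC : 0 ≤ C) (hI : ∀ n f, ‖I n f‖ ≤ C * ‖f‖) (hpq : p < q) (hq : q ≠ ∞) {h : ℝ → U →L[ℝ] H}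
    (hhq : MemLp h q (timeMeasure T)) (hh : MemLp h p (timeMeasure T)) :
    ∃ Y : Icc (0 : ℝ) T → Ω → H, (∀ t, StronglyMeasurable (Y t)) ∧
      (∀ t, Y t =ᵐ[P] operatorSum e lam I (truncLp hh t)) ∧
      ∀ ω, Continuous fun t => Y t ω := by
  set δ : ℝ := 1 / p.toReal - 1 / q.toReal with hδ_def
  have hp0 : 0 < p.toReal :=
    ENNReal.toReal_pos (zero_lt_one.trans_le (Fact.out : 1 ≤ p)).ne' hpq.ne_top
  have hpq' : p.toReal < q.toReal := (ENNReal.toReal_lt_toReal hpq.ne_top hq).2 hpq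
  have hδ : 0 < δ := sub_pos.2 (one_div_lt_one_div_of_lt hp0 hpq')
  -- The moment of order 2k turns the Hölder exponent δ into 2kδ, which must reach the exponent 4 of
  -- the continuity criterion.
  obtain ⟨k, hk⟩ := exists_nat_ge (2 / δ)
  have hk0 : k ≠ 0 := by
    rintro rfl
    exact absurd hk (not_le.2 (by simpa using hδ))
  have hkδ : 4 ≤ δ * (2 * k) := by
    rw [div_le_iff₀ hδ] at hk
    linarith
  obtain ⟨c, hc⟩ := exists_lintegral_enorm_pow_le (P := P) (H := H) k hk0
  choose A hcard hnet using exists_net_Icc hT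
  let F : Icc (0 : ℝ) T → Lp (U →L[ℝ] H) p (timeMeasure T) := fun t => truncLp hh t
  have hsum0 : 0 ≤ ∑' n, √(lam n) := tsum_nonneg fun n => Real.sqrt_nonneg _
  obtain ⟨S, hS_top, hS⟩ : ∃ S : ℝ≥0∞, S ≠ ∞ ∧ ∀ f, ‖operatorSum e lam I f‖ₑ ≤ S * ‖f‖ₑ := by
    refine ⟨ENNReal.ofReal ((∑' n, √(lam n)) * C), ENNReal.ofReal_ne_top, fun f => ?_⟩
    rw [← ofReal_norm, ← ofReal_norm, ← ENNReal.ofReal_mul (mul_nonneg hsum0 hC)]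
    exact ENNReal.ofReal_le_ofReal
      ((norm_operatorSum_le e hlam hC hI f).trans_eq (mul_assoc _ _ _).symm)
  let B : ℝ≥0∞ := eLpNorm h q (timeMeasure T)
  have hincr : ∀ s t, ‖operatorSum e lam I (F s - F t)‖ₑ ≤ S * (B * edist s t ^ δ) := by
    intro s t
    refine (hS _).trans ?_
    gcongr
    exact enorm_truncLp_sub_le hpq.le hh hδ.le s t
  -- The surplus 2kδ - 4 ≥ 0 is absorbed by the diameter T of the interval.
  have hed : ∀ s t : Icc (0 : ℝ) T, (edist s t ^ δ) ^ (2 * k) ≤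
      ENNReal.ofReal T ^ (δ * (2 * k) - 4) * edist s t ^ 4 := by
    intro s t
    have hle : edist s t ≤ ENNReal.ofReal T := by
      rw [edist_dist]
      refine ENNReal.ofReal_le_ofReal ?_
      rw [Subtype.dist_eq]
      exact (Real.dist_le_of_mem_Icc s.2 t.2).trans_eq (sub_zero T)
    rw [← ENNReal.rpow_natCast, ← ENNReal.rpow_mul, ← ENNReal.rpow_natCast]
    have h1 : δ * ((2 * k : ℕ) : ℝ) = (δ * (2 * k) - 4) + ((4 : ℕ) : ℝ) := by push_cast; ring
    rw [h1, ENNReal.rpow_add_of_nonneg _ _ (by linarith) (by positivity)]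
    gcongr
  refine exists_continuous_modification (fun t ω => operatorSum e lam I (F t) ω)
    (fun t => Lp.stronglyMeasurable _) A (2 * T) hcard hnet (q := 2 * k) (by simpa using hk0)
    (M := c * (S * B) ^ (2 * k) * ENNReal.ofReal T ^ (δ * (2 * k) - 4)) ?_ fun s t => ?_
  · refine ENNReal.mul_ne_top (ENNReal.mul_ne_top ENNReal.coe_ne_top (ENNReal.pow_ne_top
      (ENNReal.mul_ne_top hS_top hhq.2.ne))) (ENNReal.rpow_ne_top_of_nonneg (by linarith) ENNReal.ofReal_ne_top)
  · have h1 := hc (operatorSum e lam I (F s - F t)) fun L =>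
      hgauss _ (compLpL_operatorSum_mem e hG hmem hlam hC hI L _)
    have h2 : (fun ω => ‖operatorSum e lam I (F s) ω - operatorSum e lam I (F t) ω‖ₑ ^ (2 * k)) =ᵐ[P]
        fun ω => ‖operatorSum e lam I (F s - F t) ω‖ₑ ^ (2 * k) := by
      rw [operatorSum_sub e hlam hC hI]
      filter_upwards [Lp.coeFn_sub (operatorSum e lam I (F s)) (operatorSum e lam I (F t))] with ω hω
      rw [hω, Pi.sub_apply]
    rw [lintegral_congr_ae h2]
    calc _ ≤ c * ‖operatorSum e lam I (F s - F t)‖ₑ ^ (2 * k) := h1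
      _ ≤ c * (S * (B * edist s t ^ δ)) ^ (2 * k) := by
        gcongr
        exact hincr s t
      _ = c * (S * B) ^ (2 * k) * (edist s t ^ δ) ^ (2 * k) := by
        rw [← mul_assoc S, mul_pow (S * B), mul_assoc]
      _ ≤ c * (S * B) ^ (2 * k) * (ENNReal.ofReal T ^ (δ * (2 * k) - 4) * edist s t ^ 4) := by
        gcongr
        exact hed s t
      _ = _ := (mul_assoc _ _ _).symm

end OperatorSeries

/-! ### The two covariance formulas -/

section CovarianceFormulas

variable {Ω : Type*} [MeasurableSpace Ω] {P : Measure Ω} {T : ℝ} {φ : ℝ → ℝ → ℝ} {p : ℝ≥0∞}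
  [Fact (1 ≤ p)] {U : Type*} [NormedAddCommGroup U] [InnerProductSpace ℝ U]
  {H : Type*} [NormedAddCommGroup H] [InnerProductSpace ℝ H]
  (e : HilbertBasis ℕ ℝ U) {lam : ℕ → ℝ}
  {I : ℕ → Lp H p (timeMeasure T) →L[ℝ] Lp H 2 P}
  {J : ℕ → Lp ℝ p (timeMeasure T) →L[ℝ] Lp ℝ 2 P}
  {h₁ h₂ : ℝ → U →L[ℝ] H}

theorem indicator_Ioc_ae_eq {E : Type*} [Zero E] (f : ℝ → E) :
    (Ioc 0 T).indicator f =ᵐ[timeMeasure T] f := by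
  refine (ae_restrict_iff' measurableSet_Icc).2 ?_
  filter_upwards [compl_mem_ae_iff.2 (measure_singleton (μ := volume) (0 : ℝ))] with u hu hu'
  exact indicator_of_mem (show u ∈ Ioc 0 T from ⟨lt_of_le_of_ne hu'.1 (Ne.symm hu), hu'.2⟩) f

theorem evalLp_truncLp_ae_eq (u : U) (hh : MemLp h₁ p (timeMeasure T)) :
    evalLp u (truncLp hh T) =ᵐ[timeMeasure T] fun s => h₁ s u := by
  filter_upwards [coeFn_evalLp u (truncLp hh T), coeFn_truncLp hh T, indicator_Ioc_ae_eq h₁]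
    with s hs1 hs2 hs3
  rw [hs1, hs2, hs3]

omit [Fact (1 ≤ p)] in
theorem memLp_apply {h : ℝ → U →L[ℝ] H} (u : U) (hh : MemLp h p (timeMeasure T)) :
    MemLp (fun s => h s u) p (timeMeasure T) :=
  (ContinuousLinearMap.apply ℝ H u).comp_memLp' hh

theorem norm_apply_basis_le (A : U →L[ℝ] H) (n : ℕ) : ‖A (e n)‖ ≤ ‖A‖ := by
  simpa [e.orthonormal.1 n] using A.le_opNorm (e n)

variable [CompleteSpace U] [CompleteSpace H]

theorem KernelCondition.inner_operatorSum_eq (hφ : KernelCondition T φ p) (hT : 0 ≤ T)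
    (hI : ∀ n f k, ⟪I n f, I n k⟫ = kernelForm T φ f k)
    (horth : ∀ n m, n ≠ m → ∀ f k, ⟪I n f, I m k⟫ = 0) (hlam : ∀ n, 0 ≤ lam n)
    (hlam_sum : Summable fun n => |lam n|) (hsum : ∀ h, Summable (operatorTerm e lam I h))
    (hh₁ : MemLp h₁ p (timeMeasure T)) (hh₂ : MemLp h₂ p (timeMeasure T))
    {ι : Type*} (b : HilbertBasis ι ℝ H) :
    Integrable (fun z : ℝ × ℝ =>
        trace b (h₂ z.2 ∘L covOp e lam ∘L (h₁ z.1)†) * φ z.1 z.2)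
      ((timeMeasure T).prod (timeMeasure T)) ∧
    ⟪operatorSum e lam I (truncLp hh₁ T), operatorSum e lam I (truncLp hh₂ T)⟫ =
      ∫ s' in (0 : ℝ)..T, ∫ s in (0 : ℝ)..T,
        trace b (h₂ s' ∘L covOp e lam ∘L (h₁ s)†) * φ s s' := by
  simp only [trace_comp_covOp_comp_adjoint e hlam_sum]
  obtain ⟨hint, hs⟩ := hφ.hasSum_kernelForm Fact.out hlam_sum
    (fun n => memLp_apply (e n) hh₁) (fun n => memLp_apply (e n) hh₂) hh₁ hh₂ 1 fun n u v => by
      rw [one_mul]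
      gcongr <;> exact norm_apply_basis_le e _ n
  refine ⟨hint, ?_⟩
  rw [integral_timeMeasure_prod hT hint] at hs
  refine HasSum.unique ?_ hs
  refine (hasSum_inner_of_orthogonal hI horth hlam (hsum _).hasSum (hsum _).hasSum).congr_fun
    fun n => ?_
  rw [kernelForm_congr (evalLp_truncLp_ae_eq (e n) hh₁) (evalLp_truncLp_ae_eq (e n) hh₂)]

/-- Pairing with x and y commutes with the integrals by `hIJ`, so both factors become real series in
the `J n`, to which orthogonality applies. -/
theorem KernelCondition.integral_inner_mul_inner_operatorSum_eq (hφ : KernelCondition T φ p)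
    (hT : 0 ≤ T) (hJ : ∀ n f k, ⟪J n f, J n k⟫ = kernelForm T φ f k)
    (horth : ∀ n m, n ≠ m → ∀ f k, ⟪J n f, J m k⟫ = 0)
    (hIJ : ∀ n (L : H →L[ℝ] ℝ) f, L.compLpL 2 P (I n f) = J n (L.compLpL p (timeMeasure T) f))
    (hlam : ∀ n, 0 ≤ lam n)
    (hlam_sum : Summable fun n => |lam n|) (hsum : ∀ h, Summable (operatorTerm e lam I h))
    (hh₁ : MemLp h₁ p (timeMeasure T)) (hh₂ : MemLp h₂ p (timeMeasure T)) (x y : H) :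
    Integrable (fun z : ℝ × ℝ =>
        ⟪(h₂ z.2 ∘L covOp e lam ∘L (h₁ z.1)†) x, y⟫ * φ z.1 z.2)
      ((timeMeasure T).prod (timeMeasure T)) ∧
    ∫ ω, ⟪operatorSum e lam I (truncLp hh₁ T) ω, x⟫ *
        ⟪operatorSum e lam I (truncLp hh₂ T) ω, y⟫ ∂P =
      ∫ s' in (0 : ℝ)..T, ∫ s in (0 : ℝ)..T,
        ⟪(h₂ s' ∘L covOp e lam ∘L (h₁ s)†) x, y⟫ * φ s s' := by
  simp only [inner_comp_covOp_comp_adjoint e hlam_sum]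
  obtain ⟨hint, hs⟩ := hφ.hasSum_kernelForm (K := ℝ) Fact.out hlam_sum
    (fun n => (innerSL ℝ x).comp_memLp' (memLp_apply (e n) hh₁))
    (fun n => (innerSL ℝ y).comp_memLp' (memLp_apply (e n) hh₂)) hh₁ hh₂ (‖x‖ * ‖y‖)
    fun n u v => by
      have hxy : ∀ (z : H) (A : U →L[ℝ] H), ‖⟪z, A (e n)⟫‖ ≤ ‖z‖ * ‖A‖ := fun z A =>
        (norm_inner_le_norm _ _).trans (by gcongr; exact norm_apply_basis_le e A n)
      calc _ ≤ (‖x‖ * ‖h₁ u‖) * (‖y‖ * ‖h₂ v‖) :=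
            mul_le_mul (hxy x (h₁ u)) (hxy y (h₂ v)) (norm_nonneg _) (by positivity)
        _ = _ := by ring
  refine ⟨hint, ?_⟩
  rw [integral_timeMeasure_prod hT hint] at hs
  refine HasSum.unique ?_ hs
  have hX : ∀ (z : H) {h : ℝ → U →L[ℝ] H} (hh : MemLp h p (timeMeasure T)),
      HasSum (fun n => √(lam n) • J n ((innerSL ℝ z).compLpL p (timeMeasure T)
        (evalLp (e n) (truncLp hh T))))
        ((innerSL ℝ z).compLpL 2 P (operatorSum e lam I (truncLp hh T))) := by
    intro z h hh
    refine ((hsum (truncLp hh T)).hasSum.mapL ((innerSL ℝ z).compLpL 2 P)).congr_fun fun n => ?_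
    rw [operatorTerm, map_smul, hIJ]
  have hae : ∀ (z : H) {h : ℝ → U →L[ℝ] H} (hh : MemLp h p (timeMeasure T)) (n : ℕ),
      (innerSL ℝ z).compLpL p (timeMeasure T) (evalLp (e n) (truncLp hh T)) =ᵐ[timeMeasure T]
        (innerSL ℝ z) ∘ fun s => h s (e n) := by
    intro z h hh n
    filter_upwards [(innerSL ℝ z).coeFn_compLpL (evalLp (e n) (truncLp hh T)),
      evalLp_truncLp_ae_eq (e n) hh] with s hs1 hs2
    rw [hs1, hs2, Function.comp_apply]
  have hinner : ∫ ω, ⟪operatorSum e lam I (truncLp hh₁ T) ω, x⟫ *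
        ⟪operatorSum e lam I (truncLp hh₂ T) ω, y⟫ ∂P =
      ⟪(innerSL ℝ x).compLpL 2 P (operatorSum e lam I (truncLp hh₁ T)),
        (innerSL ℝ y).compLpL 2 P (operatorSum e lam I (truncLp hh₂ T))⟫ := by
    rw [L2.inner_def]
    refine integral_congr_ae ?_
    filter_upwards [(innerSL ℝ x).coeFn_compLpL (operatorSum e lam I (truncLp hh₁ T)),
      (innerSL ℝ y).coeFn_compLpL (operatorSum e lam I (truncLp hh₂ T))] with ω hω1 hω2
    rw [hω1, hω2, innerSL_apply_apply, innerSL_apply_apply, real_inner_comm, real_inner_comm _ y]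
    simp [mul_comm]
  rw [hinner]
  refine (hasSum_inner_of_orthogonal hJ horth hlam (hX x hh₁) (hX y hh₂)).congr_fun fun n => ?_
  rw [kernelForm_congr (hae x hh₁ n) (hae y hh₂ n)]

end CovarianceFormulas

/-! ### Matching the definitions with the operator series -/

section WienerIntegralFamily

variable {Ω : Type*} [MeasurableSpace Ω] {P : Measure Ω} {T : ℝ} {φ : ℝ → ℝ → ℝ} {p : ℝ≥0∞}
  [Fact (1 ≤ p)] {U : Type*} [NormedAddCommGroup U] [InnerProductSpace ℝ U]
  {H : Type*} [NormedAddCommGroup H] [InnerProductSpace ℝ H]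

theorem isWienerIntegral_wienerIntegralL [CompleteSpace H] {g : Icc (0 : ℝ) T → Ω → ℝ} (hT : 0 ≤ T)
    (hp : p ≠ ∞) (hφ : KernelCondition T φ p) (hg : ∀ t, MemLp (g t) 2 P)
    (hR : ∀ t s, ∫ ω, g t ω * g s ω ∂P = kernelCov φ t s) :
    IsWienerIntegral P p g (wienerIntegralL P p g : Lp H p (timeMeasure T) →L[ℝ] Lp H 2 P) := by
  have h := exists_isWienerIntegral (H := H) hT hp hφ hg hR
  rw [wienerIntegralL, dif_pos h]
  exact h.choose_spec

theorem gaussianTerm_eq_operatorTerm (g : ℕ → Icc (0 : ℝ) T → Ω → ℝ) (e : HilbertBasis ℕ ℝ U)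
    (lam : ℕ → ℝ) {h : ℝ → U →L[ℝ] H} (hh : MemLp h p (timeMeasure T)) (t : ℝ) :
    gaussianTerm P p g e lam h t =
      operatorTerm e lam (fun n => wienerIntegralL P p (g n)) (truncLp hh t) := by
  ext1 n
  have hm : MemLp ((Ioc 0 t).indicator fun s => h s (e n)) p (timeMeasure T) :=
    (memLp_apply (e n) hh).indicator measurableSet_Ioc
  -- Membership in L^p selects the genuine branch of `wienerIntegral` rather than its default value
  -- zero.
  rw [gaussianTerm, operatorTerm, wienerIntegral, dif_pos hm]
  congr 2
  refine Lp.ext ?_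
  filter_upwards [hm.coeFn_toLp, coeFn_evalLp (e n) (truncLp hh t), coeFn_truncLp hh t]
    with s hs1 hs2 hs3
  rw [hs1, hs2, hs3]
  by_cases hs : s ∈ Ioc 0 t <;> simp [indicator, hs, -mem_Ioc]

theorem gaussianIntegral_eq_operatorSum (g : ℕ → Icc (0 : ℝ) T → Ω → ℝ) (e : HilbertBasis ℕ ℝ U)
    (lam : ℕ → ℝ) {h : ℝ → U →L[ℝ] H} (hh : MemLp h p (timeMeasure T)) (t : ℝ) :
    gaussianIntegral P p g e lam h t =
      operatorSum e lam (fun n => wienerIntegralL P p (g n)) (truncLp hh t) := by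
  rw [gaussianIntegral, operatorSum, gaussianTerm_eq_operatorTerm g e lam hh]

end WienerIntegralFamily

end GaussianIntegral

end

/-! ### The main theorem -/

open GaussianIntegral in
theorem proposition1
    {Ω : Type*} [MeasurableSpace Ω] (P : Measure Ω) [IsProbabilityMeasure P]
    {U : Type*} [NormedAddCommGroup U] [InnerProductSpace ℝ U] [CompleteSpace U]
    {H : Type*} [NormedAddCommGroup H] [InnerProductSpace ℝ H] [CompleteSpace H]
    [TopologicalSpace.SeparableSpace H] [MeasurableSpace H] [BorelSpace H]
    (T : ℝ) (hT : 0 < T) (φ : ℝ → ℝ → ℝ)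
    (p : ℝ≥0∞) [Fact (1 ≤ p)] (hp : 1 < p) (hp' : p < ∞) (hφ : KernelCondition T φ p)
    -- `g 0, g 1, …` are independent centred Gaussian processes with covariance function `R`
    (g : ℕ → Icc (0 : ℝ) T → Ω → ℝ)
    (hg_meas : ∀ n t, Measurable (g n t))
    (hg_gauss : ∀ n, IsGaussianProcess (g n) P)
    (hg_mean : ∀ n t, ∫ ω, g n t ω ∂P = 0)
    (hg_cov : ∀ n t s, covariance (g n t) (g n s) P = kernelCov φ t s)
    (hg_indep : iIndepFun (fun n ω t => g n t ω) P)
    (e : HilbertBasis ℕ ℝ U) (lam : ℕ → ℝ) (hlam : ∀ n, 0 < lam n)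
    (hlam_sum : Summable fun n => √(lam n)) :
    -- the integrals with respect to `g n` are well defined, and so is the one for `G`
    (∀ n, (∃! I : Lp H p (timeMeasure T) →L[ℝ] Lp H 2 P, IsWienerIntegral P p (g n) I) ∧
      IsWienerIntegral P p (g n) (wienerIntegralL P p (g n) : Lp H p (timeMeasure T) →L[ℝ] _)) ∧
    (∀ h : ℝ → U →L[ℝ] H, MemLp h p (timeMeasure T) → ∀ t ∈ Icc 0 T,
      Summable (gaussianTerm P p g e lam h t)) ∧
    -- `∫_0^· h dG` is an `H`-valued Gaussian process
    (∀ h : ℝ → U →L[ℝ] H, MemLp h p (timeMeasure T) →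
      IsGaussianProcess
        (fun (t : Icc (0 : ℝ) T) (ω : Ω) => gaussianIntegral P p g e lam h t ω) P) ∧
    -- with continuous sample paths (after modification) if `h ∈ L^{p+ε}`
    (∀ (ε : ℝ≥0) (h : ℝ → U →L[ℝ] H), 0 < ε → MemLp h (p + ε) (timeMeasure T) →
      ∃ Y : Icc (0 : ℝ) T → Ω → H, (∀ t, StronglyMeasurable (Y t)) ∧
        (∀ t, Y t =ᵐ[P] gaussianIntegral P p g e lam h t) ∧
        ∀ ω, Continuous fun t => Y t ω) ∧
    -- the covariance formulas
    (∀ h₁ h₂ : ℝ → U →L[ℝ] H, MemLp h₁ p (timeMeasure T) → MemLp h₂ p (timeMeasure T) →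
      (∀ x y : H,
        Integrable (fun z : ℝ × ℝ =>
            ⟪(h₂ z.2 ∘L covOp e lam ∘L (h₁ z.1)†) x, y⟫ * φ z.1 z.2)
          ((timeMeasure T).prod (timeMeasure T)) ∧
        ∫ ω, ⟪gaussianIntegral P p g e lam h₁ T ω, x⟫ *
            ⟪gaussianIntegral P p g e lam h₂ T ω, y⟫ ∂P =
          ∫ s' in (0 : ℝ)..T, ∫ s in (0 : ℝ)..T,
            ⟪(h₂ s' ∘L covOp e lam ∘L (h₁ s)†) x, y⟫ * φ s s') ∧
      (∀ s s' : ℝ, IsTraceClass (h₂ s' ∘L covOp e lam ∘L (h₁ s)†)) ∧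
      ∀ (ι : Type*) (b : HilbertBasis ι ℝ H),
        Integrable (fun z : ℝ × ℝ =>
            trace b (h₂ z.2 ∘L covOp e lam ∘L (h₁ z.1)†) * φ z.1 z.2)
          ((timeMeasure T).prod (timeMeasure T)) ∧
        ∫ ω, ⟪gaussianIntegral P p g e lam h₁ T ω, gaussianIntegral P p g e lam h₂ T ω⟫ ∂P =
          ∫ s' in (0 : ℝ)..T, ∫ s in (0 : ℝ)..T,
            trace b (h₂ s' ∘L covOp e lam ∘L (h₁ s)†) * φ s s') := by
  have := UniformSpace.secondCountable_of_separable H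
  have hp_top : p ≠ ∞ := hp'.ne
  have hg2 : ∀ n t, MemLp (g n t) 2 P := fun n t => ((hg_gauss n).hasGaussianLaw_eval t).memLp_two
  have hR : ∀ n t s, ∫ ω, g n t ω * g n s ω ∂P = kernelCov φ t s := by
    intro n t s
    rw [← hg_cov n t s, covariance_eq_sub (hg2 n t) (hg2 n s), hg_mean, zero_mul, sub_zero]
    rfl
  have horth : ∀ n m, n ≠ m → ∀ t s, ∫ ω, g n t ω * g m s ω ∂P = 0 := by
    intro n m hnm t s
    have hind : IndepFun (g n t) (g m s) P :=
      (hg_indep.indepFun hnm).comp (measurable_pi_apply t) (measurable_pi_apply s)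
    rw [hind.integral_fun_mul_eq_mul_integral (hg2 n t).1 (hg2 m s).1, hg_mean, zero_mul]
  have hI : ∀ n, IsWienerIntegral P p (g n)
      (wienerIntegralL P p (g n) : Lp H p (timeMeasure T) →L[ℝ] Lp H 2 P) := fun n =>
    isWienerIntegral_wienerIntegralL hT.le hp_top hφ (hg2 n) (hR n)
  have hJ : ∀ n, IsWienerIntegral P p (g n)
      (wienerIntegralL P p (g n) : Lp ℝ p (timeMeasure T) →L[ℝ] Lp ℝ 2 P) := fun n =>
    isWienerIntegral_wienerIntegralL hT.le hp_top hφ (hg2 n) (hR n)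
  obtain ⟨C, hC, hCI⟩ := exists_norm_isWienerIntegral_le (P := P) (H := H) hT.le hp_top hφ
  have hbound : ∀ n f, ‖(wienerIntegralL P p (g n) : Lp H p (timeMeasure T) →L[ℝ] Lp H 2 P) f‖ ≤
      C * ‖f‖ := fun n => hCI (g n) (hg2 n) (hR n) _ (hI n)
  have hlam0 : ∀ n, 0 ≤ lam n := fun n => (hlam n).le
  -- Eventually √λ_n ≤ 1, and then λ_n ≤ √λ_n.
  have hlam_abs : Summable fun n => |lam n| := by
    refine hlam_sum.of_norm_bounded_eventually_nat ?_
    filter_upwards [hlam_sum.tendsto_atTop_zero.eventually_le_const zero_lt_one] with n hn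
    rw [Real.norm_eq_abs, abs_abs, abs_of_nonneg (hlam0 n)]
    calc lam n = √(lam n) * √(lam n) := (Real.mul_self_sqrt (hlam0 n)).symm
      _ ≤ √(lam n) := mul_le_of_le_one_right (Real.sqrt_nonneg _) hn
  obtain ⟨G, hG, hgG, hgauss⟩ := exists_gaussianSpace hg_gauss hg_mean hg_indep hg2
  have hmem : ∀ n (L : H →L[ℝ] ℝ) f, L.compLpL 2 P
      ((wienerIntegralL P p (g n) : Lp H p (timeMeasure T) →L[ℝ] Lp H 2 P) f) ∈ G := fun n =>
    (hI n).compLpL_inner_mem hG hT.le hp_top (hg2 n) (hR n) (hgG n)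
  have hsum := summable_operatorTerm e hlam_sum hC hbound
  refine ⟨fun n => ⟨⟨_, hI n, fun J hJ' => hJ'.eq hT.le hp_top (hg2 n) (hR n) (hI n)⟩, hI n⟩,
    fun h hh t _ => ?_, fun h hh => ?_, fun ε h hε hh => ?_, fun h₁ h₂ hh₁ hh₂ => ⟨fun x y => ?_,
      fun s s' => isTraceClass_comp_covOp_comp_adjoint e hlam_abs _ _, fun ι b => ?_⟩⟩
  · rw [gaussianTerm_eq_operatorTerm g e lam hh]
    exact hsum _
  · refine isGaussianProcess_of_compLpL_map_eq hgauss fun t L => ?_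
    rw [gaussianIntegral_eq_operatorSum g e lam hh]
    exact compLpL_operatorSum_mem e hG hmem hlam_sum hC hbound L _
  · have hh' : MemLp h p (timeMeasure T) := hh.mono_exponent le_self_add
    simp only [gaussianIntegral_eq_operatorSum g e lam hh']
    refine exists_continuous_operatorSum e hT hG hgauss hmem hlam_sum hC hbound
      (ENNReal.lt_add_right hp_top (by exact_mod_cast hε.ne'))
      (ENNReal.add_ne_top.2 ⟨hp_top, ENNReal.coe_ne_top⟩) hh hh'
  · rw [gaussianIntegral_eq_operatorSum g e lam hh₁, gaussianIntegral_eq_operatorSum g e lam hh₂]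
    exact hφ.integral_inner_mul_inner_operatorSum_eq e hT.le
      (fun n => (hJ n).inner_eq hT.le hp_top hφ (hg2 n) (hR n))
      (fun n m hnm => (hJ n).inner_eq_zero hT.le hp_top (hg2 n) (hR n) (hg2 m) (hR m)
        (horth n m hnm) (hJ m))
      (fun n L => (hI n).compLpL_apply hT.le hp_top (hg2 n) (hR n) (hJ n) L)
      hlam0 hlam_abs hsum hh₁ hh₂ x y
  · have h := hφ.inner_operatorSum_eq e hT.le
      (fun n => (hI n).inner_eq hT.le hp_top hφ (hg2 n) (hR n))
      (fun n m hnm => (hI n).inner_eq_zero hT.le hp_top (hg2 n) (hR n) (hg2 m) (hR m)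
        (horth n m hnm) (hI m)) hlam0 hlam_abs hsum hh₁ hh₂ b
    rwa [L2.inner_def, ← gaussianIntegral_eq_operatorSum g e lam hh₁,
      ← gaussianIntegral_eq_operatorSum g e lam hh₂] at h
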